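/- Let $p$ be a prime, $G=\mathbb Q_p$ (additive group), $G_n=\{x:|x|_p\le p^{-n}\}$, $\mu$ the Haar measure with $\mu(G_0)=1$, $X$ the group of characters of $G$, $G_n^\bot\subset X$ the annihilator of $G_n$, $\nu$ the Haar measure on $X$ with $\nu(G_0^\bot)=1$, and $\hat f(\chi)=\int_G f(x)\overline{\chi(x)}\,d\mu(x)$ the Fourier transform on $L_2(G)$ (defined as an $L_2$-limit). For $\chi\in G_n^\bot\setminus G_{n-1}^\bot$ put $|\chi|_p=p^n$, put $|1|_p=0$, and let $\log_p^+|\chi|_p=\log_p|\chi|_p$ if $|\chi|_p>1$ and $\log_p^+|\chi|_p=0$ otherwise. Let $\mathcal A x=p^{-1}x$, $(\chi\mathcal A^n)(x)=\chi(\mathcal A^n x)$ (so $|\chi\mathcal A^n|_p=p^n|\chi|_p$), and let $H_0$ be the set of all finite sums $a_{-1}p^{-1}+\dots+a_{-s}p^{-s}$ with $a_j\in\{0,\dots,p-1\}$. Let $M,N\ge 1$ be integers, and let $\varphi$ be a refinable function, $\varphi(x)=p\sum_{h\in H_0}\beta_h\varphi(\mathcal Ax-h)$ (finite sum), supported in $G_{-N}$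 and constant on the cosets of $G_M$. Let $m_j(\chi)=\sum_{h\in H_0}\beta^{(j)}_h\overline{(\chi\mathcal A^{-1})(h)}$ (finite sums), $1\le j\le q$, be masks with $\hat\varphi(\chi\mathcal A^{-1})m_j(\chi)=\mathbf 1_{E_j}(\chi)$, where $E_1,\dots,E_q$ are disjoint, $E_j\subset G_{M+1}^\bot$ is a coset of $G_{-s(j)}^\bot$, $0\le s(j)\le N$, and suppose there are integers $t(j)\ge0$ with $\bigsqcup_jE_j\mathcal A^{t(j)}=G_{M+1}^\bot\setminus G_M^\bot$. Put $l=\max_jt(j)$, $\psi_j(x)=p\sum_{h}\beta_h^{(j)}\varphi(\mathcal Ax-h)$ and $\psi^{(j)}_{n,h}(x)=p^{n/2}\psi_j(\mathcal A^nx-h)$. For $f\in L_2(G)$ and an integer $\tilde N>N$ let $$R_{\tilde N}=\Big\|f-\sum_{n=-\infty}^{\tilde N}\sum_{j=1}^q\sum_{h\in H_0}\langle f,\psi^{(j)}_{n,h}\rangle\psi^{(j)}_{n,h}\Big\|_2 .$$ Then the series converges unconditionally in $L_2(G)$ and the following hold (integrals may be $+\infty$). 1. Let $(\gamma_n)_{n\in\mathbb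 Z}$ be non-decreasing with $\gamma_n\to+\infty$ as $n\to+\infty$, $\gamma_n=1$ for $n<0$ and $\sum_{n\ge0}1/\gamma_n<\infty$, and let $\gamma(\chi)=\gamma_n$ for $\chi\in G_n^\bot\setminus G_{n-1}^\bot$. Then $$R_{\tilde N}\le (N+1)p^{\frac{M-1}2}\Big(\int_X\gamma^2(\chi\mathcal A^l)|\hat f(\chi)|^2d\nu\Big)^{1/2}\sum_{n=\tilde N+1}^\infty\frac1{\gamma_{n+1}}.$$ 2. (The case $\gamma_k=p^{km}$, $k\ge0$.) For every real $m>0$, $$R_{\tilde N}\le \frac{(N+1)p^{\frac{M-1}2}}{(p^m-1)p^{m(\tilde N+1)}}\Big(\int_X\big(1+|\chi\mathcal A^l|_p^{m}\big)^2|\hat f(\chi)|^2d\nu\Big)^{1/2}$$ and hence also $$R_{\tilde N}\le \frac{(N+1)p^{\frac{M-1}2}\,p^{ml}}{(p^m-1)p^{m(\tilde N+1)}}\Big(\int_X\big(1+|\chi|_p^{m}\big)^2|\hat f(\chi)|^2d\nu\Big)^{1/2}.$$ 3. (The case $\gamma_k=(k+1)^{1+\varepsilon/2}$, $k\ge0$.)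 For every real $\varepsilon>0$, $$R_{\tilde N}\le\frac{2(N+1)}{\varepsilon(1+\tilde N)^{\varepsilon/2}}\Big(\int_X\big(1+l+\log_p^+|\chi|_p\big)^{2+\varepsilon}|\hat f(\chi)|^2d\nu\Big)^{1/2}.$$ -/

import Mathlib

open MeasureTheory Filter Topology
open scoped ENNReal ComplexConjugate

noncomputable section

namespace PadicFrame

variable (p : ℕ) [Fact p.Prime]

instance instMeasurableSpacePadic : MeasurableSpace ℚ_[p] := borel _

instance instBorelSpacePadic : BorelSpace ℚ_[p] := ⟨rfl⟩

/-- The group `X` of (continuous unitary) characters of the additive group of `ℚ_p`. -/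
abbrev CharGroup : Type := PontryaginDual (Multiplicative ℚ_[p])

instance instMeasurableSpaceCharGroup : MeasurableSpace (CharGroup p) := borel _

instance instBorelSpaceCharGroup : BorelSpace (CharGroup p) := ⟨rfl⟩

/-- `G_n`: the p-adic numbers `∑_{k ≥ n} x_k p^k`, i.e. `|x|_p ≤ p^{-n}`. -/
def ball (n : ℤ) : Set ℚ_[p] := {x | ‖x‖ ≤ (p : ℝ) ^ (-n)}

theorem ball_eq (n : ℤ) : ball p n = Metric.closedBall 0 ((p : ℝ) ^ (-n)) := by
  ext x; simp [ball]

theorem zpow_p_pos (n : ℤ) : (0 : ℝ) < (p : ℝ) ^ n :=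
  zpow_pos (by exact_mod_cast (Fact.out : p.Prime).pos) n

/-- `G_0` as a compact set with non-empty interior. -/
def unitBall : TopologicalSpace.PositiveCompacts ℚ_[p] where
  carrier := ball p 0
  isCompact' := by rw [ball_eq]; exact isCompact_closedBall _ _
  interior_nonempty' := by
    refine ⟨0, mem_interior.2 ⟨Metric.ball 0 1, ?_, Metric.isOpen_ball, by simp⟩⟩
    rw [ball_eq]
    simpa using Metric.ball_subset_closedBall

/-- Haar measure `μ` on `ℚ_p`, normalised by `μ(G_0) = 1`. -/
def mu : Measure ℚ_[p] := Measure.addHaarMeasure (unitBall p)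

instance instIsAddHaarMeasureMu : (mu p).IsAddHaarMeasure := by
  unfold mu; infer_instance

variable {p}

/-- The value `(χ, x)` of the character `χ` at `x`. -/
def ev (χ : CharGroup p) (x : ℚ_[p]) : ℂ := (χ (Multiplicative.ofAdd x) : ℂ)

variable (p) in
/-- The annihilator `G_n^⊥` of `G_n`. -/
def annih (n : ℤ) : Set (CharGroup p) := {χ | ∀ x ∈ ball p n, ev χ x = 1}

variable (p) in
/-- Haar measure `ν` on `X`, normalised by `ν(G_0^⊥) = 1`. -/
def nu : Measure (CharGroup p) :=
  ((Measure.haar : Measure (CharGroup p)) (annih p 0))⁻¹ • Measure.haar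

variable (p) in
/-- The power `𝒜^n` of the dilation operator `𝒜 (∑ a_k p^k) = ∑ a_k p^{k-1}`. -/
def dil (n : ℤ) (x : ℚ_[p]) : ℚ_[p] := (p : ℚ_[p]) ^ (-n) * x

variable (p) in
theorem continuous_dil (n : ℤ) : Continuous (dil p n) := by
  unfold dil; fun_prop

variable (p) in
/-- `𝒜^n` as a continuous endomorphism of the additive group of `ℚ_p`. -/
def dilHom (n : ℤ) : Multiplicative ℚ_[p] →ₜ* Multiplicative ℚ_[p] where
  toFun x := Multiplicative.ofAdd (dil p n x.toAdd)
  map_one' := by simp [dil]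
  map_mul' x y := by simp [dil, mul_add]
  continuous_toFun :=
    continuous_ofAdd.comp ((continuous_dil p n).comp continuous_toAdd)

/-- `χ 𝒜^n`, the character with `(χ 𝒜^n, x) = (χ, 𝒜^n x)`. -/
def cdil (n : ℤ) (χ : CharGroup p) : CharGroup p := PontryaginDual.map (dilHom p n) χ

theorem ev_cdil (n : ℤ) (χ : CharGroup p) (x : ℚ_[p]) : ev (cdil n χ) x = ev χ (dil p n x) := rfl

/-- For `χ ≠ 1`, the integer `n` with `χ ∈ G_n^⊥ \ G_{n-1}^⊥`. -/
def level (χ : CharGroup p) : ℤ := sInf {n : ℤ | χ ∈ annih p n}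

open Classical in
/-- `|χ|_p = p^n` for `χ ∈ G_n^⊥ \ G_{n-1}^⊥`, and `|1|_p = 0`. -/
def cnorm (χ : CharGroup p) : ℝ := if χ = 1 then 0 else (p : ℝ) ^ level χ

/-- `log_p^+ |χ|_p`: it is `log_p |χ|_p` if `|χ|_p > 1` and `0` otherwise. -/
def logPlus (χ : CharGroup p) : ℝ := if 1 < cnorm χ then Real.logb p (cnorm χ) else 0

open Classical in
/-- The step weight: `γ(χ) = γ_n` on `G_n^⊥ \ G_{n-1}^⊥` (and `γ(1) = 1`; `{1}` is a null set). -/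
def stepWeight (γ : ℤ → ℝ) (χ : CharGroup p) : ℝ := if χ = 1 then 1 else γ (level χ)

/-- The Fourier integral `∫ f(x) conj (χ, x) dμ(x)` of an integrable function. -/
def fourierInt (f : ℚ_[p] → ℂ) (χ : CharGroup p) : ℂ := ∫ x, f x * conj (ev χ x) ∂(mu p)

/-- `F` is the Fourier transform of `f ∈ L₂(ℚ_p)`: the limit in `L₂(X)`, as `n → ∞`, of
`∫_{G_{-n}} f(x) conj (χ, x) dμ(x)`. -/
def IsFourierTransform (f : ℚ_[p] → ℂ) (F : CharGroup p → ℂ) : Prop :=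
  MemLp F 2 (nu p) ∧
  Tendsto (fun n : ℕ => eLpNorm
    (fun χ => F χ - ∫ x in ball p (-(n : ℤ)), f x * conj (ev χ x) ∂(mu p)) 2 (nu p))
    atTop (𝓝 0)

open Classical in
/-- The Fourier transform of `f ∈ L₂(ℚ_p)`, a function on `X` determined up to a null set. -/
def fhat (f : ℚ_[p] → ℂ) : CharGroup p → ℂ :=
  if h : ∃ F, IsFourierTransform f F then h.choose else 0

variable (p) in
/-- `H_0`: all `a_{-1} p^{-1} + ⋯ + a_{-s} p^{-s}` with digits `0 ≤ a_j ≤ p - 1`. -/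
def H0 : Set ℚ_[p] :=
  {h | ∃ (s : ℕ) (a : ℕ → ℕ), (∀ i, a i < p) ∧
    h = ∑ i ∈ Finset.range s, (a i : ℚ_[p]) * (p : ℚ_[p]) ^ (-((i : ℤ) + 1))}

/-- The class `𝔇_M(G_{-N})`: supported in `G_{-N}` and constant on the cosets of `G_M`. -/
def StepClass (M N : ℤ) (f : ℚ_[p] → ℂ) : Prop :=
  (∀ x, x ∉ ball p (-N) → f x = 0) ∧ ∀ x, ∀ y ∈ ball p M, f (x + y) = f x

/-- `x ↦ p ∑_h β_h φ(𝒜x - h)`. -/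
def refineSum (φ : ℚ_[p] → ℂ) (β : H0 p →₀ ℂ) (x : ℚ_[p]) : ℂ :=
  p * β.sum fun h b => b * φ (dil p 1 x - h)

/-- The mask `m(χ) = ∑_h β_h conj (χ 𝒜⁻¹, h)`. -/
def mask (β : H0 p →₀ ℂ) (χ : CharGroup p) : ℂ :=
  β.sum fun h b => b * conj (ev (cdil (-1) χ) h)

/-- The coset `G_{-s}^⊥ η`. -/
def coset (s : ℤ) (η : CharGroup p) : Set (CharGroup p) := {χ | χ * η⁻¹ ∈ annih p (-s)}

variable (p) in
/-- A step refinable function `φ`, wavelet masks `m_1, …, m_q` with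
`φ̂(χ 𝒜⁻¹) m_j(χ) = 1_{E_j}(χ)`, and integers `t(j) ≥ 0` such that the sets `E_j 𝒜^{t(j)}` tile
`G_{M+1}^⊥ \ G_M^⊥`. The sets `E_j = G_{-s(j)}^⊥ r_{-s(j)}^{α_{-s(j)}} ⋯ r_M^{α_M}` are exactly the
cosets of `G_{-s(j)}^⊥` contained in `G_{M+1}^⊥`. -/
structure WaveletSystem (M N q : ℕ) where
  φ : ℚ_[p] → ℂ
  φ_step : StepClass M N φ
  /-- coefficients of the refinement equation -/
  β₀ : H0 p →₀ ℂ
  φ_refinable : ∀ x, φ x = refineSum φ β₀ x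
  /-- coefficients of the masks `m_j` -/
  β : Fin q → (H0 p →₀ ℂ)
  s : Fin q → ℕ
  s_le : ∀ j, s j ≤ N
  η : Fin q → CharGroup p
  η_mem : ∀ j, η j ∈ annih p (M + 1)
  t : Fin q → ℕ
  mask_eq : ∀ j χ, fourierInt φ (cdil (-1) χ) * mask (β j) χ =
    (coset (s j) (η j)).indicator 1 χ
  disjoint : ∀ i j, i ≠ j → Disjoint (coset (s i) (η i)) (coset (s j) (η j))
  disjoint_dil : ∀ i j, i ≠ j →
    Disjoint (cdil (t i) '' coset (s i) (η i)) (cdil (t j) '' coset (s j) (η j))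
  tiling : ⋃ j, cdil (t j) '' coset (s j) (η j) = annih p (M + 1) \ annih p M

theorem StepClass.continuous {M N : ℤ} {f : ℚ_[p] → ℂ} (hf : StepClass M N f) :
    Continuous f := by
  refine (IsLocallyConstant.iff_eventually_eq f).2 (fun x => ?_) |>.continuous
  filter_upwards [Metric.closedBall_mem_nhds x (zpow_p_pos p (-M))] with y hy
  have h : y - x ∈ ball p M := by simpa [ball, dist_eq_norm] using hy
  simpa using hf.2 x (y - x) h

theorem StepClass.hasCompactSupport {M N : ℤ} {f : ℚ_[p] → ℂ} (hf : StepClass M N f) :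
    HasCompactSupport f := by
  refine HasCompactSupport.intro (K := ball p (-N)) ?_ fun x hx => hf.1 x hx
  rw [ball_eq]; exact isCompact_closedBall _ _

/-- The function `x ↦ g(𝒜^n x - h)`. -/
def atom (g : ℚ_[p] → ℂ) (n : ℤ) (h : ℚ_[p]) (x : ℚ_[p]) : ℂ := g (dil p n x - h)

theorem good_atom {g : ℚ_[p] → ℂ} (hg : Continuous g) (hc : HasCompactSupport g) (n : ℤ)
    (h : ℚ_[p]) : Continuous (atom g n h) ∧ HasCompactSupport (atom g n h) := by
  have hp : (p : ℚ_[p]) ^ (-n) ≠ 0 :=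
    zpow_ne_zero _ (by exact_mod_cast (Fact.out : p.Prime).ne_zero)
  refine ⟨hg.comp ((continuous_dil p n).sub continuous_const), ?_⟩
  exact hc.comp_homeomorph ((Homeomorph.mulLeft₀ _ hp).trans (Homeomorph.subRight h))

theorem good_refine {φ : ℚ_[p] → ℂ} (hφ : Continuous φ) (hc : HasCompactSupport φ)
    (β : H0 p →₀ ℂ) : Continuous (refineSum φ β) ∧ HasCompactSupport (refineSum φ β) := by
  have e : refineSum φ β = fun x => (p : ℂ) * ∑ h ∈ β.support, β h * atom φ 1 h x := rfl
  have key : ∀ S : Finset (H0 p), Continuous (fun x => ∑ h ∈ S, β h * atom φ 1 h x) ∧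
      HasCompactSupport (fun x => ∑ h ∈ S, β h * atom φ 1 h x) := by
    classical
    intro S
    induction S using Finset.induction_on with
    | empty => simpa using ⟨continuous_const, HasCompactSupport.zero⟩
    | insert a S ha ih =>
      simp only [Finset.sum_insert ha]
      obtain ⟨h1, h2⟩ := good_atom hφ hc 1 (a : ℚ_[p])
      exact ⟨(continuous_const.mul h1).add ih.1, HasCompactSupport.add h2.mul_left ih.2⟩
  rw [e]
  exact ⟨continuous_const.mul (key _).1, (key _).2.mul_left⟩

namespace WaveletSystem

variable {M N q : ℕ} (W : WaveletSystem p M N q)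

/-- The sets `E_j`. -/
def E (j : Fin q) : Set (CharGroup p) := coset (W.s j) (W.η j)

/-- The wavelet functions `ψ_j(x) = p ∑_h β_h^{(j)} φ(𝒜x - h)`. -/
def ψ (j : Fin q) : ℚ_[p] → ℂ := refineSum W.φ (W.β j)

/-- `ψ_{n,h}^{(j)}(x) = p^{n/2} ψ_j(𝒜^n x - h)`. -/
def ψFun (n : ℤ) (j : Fin q) (h : ℚ_[p]) (x : ℚ_[p]) : ℂ :=
  (((p : ℝ) ^ ((n : ℝ) / 2) : ℝ) : ℂ) * W.ψ j (dil p n x - h)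

theorem memLp_ψFun (n : ℤ) (j : Fin q) (h : ℚ_[p]) : MemLp (W.ψFun n j h) 2 (mu p) := by
  obtain ⟨h1, h2⟩ := good_refine W.φ_step.continuous W.φ_step.hasCompactSupport (W.β j)
  obtain ⟨h3, h4⟩ := good_atom h1 h2 n h
  exact Continuous.memLp_of_hasCompactSupport (continuous_const.mul h3) h4.mul_left

/-- `ψ_{n,h}^{(j)}` as an element of `L₂(ℚ_p)`. -/
def ψL2 (n : ℤ) (j : Fin q) (h : ℚ_[p]) : Lp ℂ 2 (mu p) := (W.memLp_ψFun n j h).toLp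

/-- The terms `⟨f, ψ_{n,h}^{(j)}⟩ ψ_{n,h}^{(j)}` with `n ≤ K`, `1 ≤ j ≤ q`, `h ∈ H_0`. -/
def term (f : Lp ℂ 2 (mu p)) (K : ℤ) (i : {n : ℤ // n ≤ K} × Fin q × H0 p) : Lp ℂ 2 (mu p) :=
  inner ℂ (W.ψL2 i.1 i.2.1 i.2.2) f • W.ψL2 i.1 i.2.1 i.2.2

/-- The approximation error
`R_K(f) = ‖f - ∑_{n ≤ K} ∑_j ∑_{h ∈ H_0} ⟨f, ψ_{n,h}^{(j)}⟩ ψ_{n,h}^{(j)}‖₂`. -/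
def err (f : Lp ℂ 2 (mu p)) (K : ℤ) : ℝ≥0∞ := ‖f - ∑' i, W.term f K i‖ₑ

/-- `l = max_j t(j)`. -/
def l : ℕ := Finset.univ.sup W.t

end WaveletSystem

/-- `(∫_X w(χ)² |f̂(χ)|² dν(χ))^{1/2} ∈ [0, ∞]`. -/
def weightedNorm (w : CharGroup p → ℝ) (f : Lp ℂ 2 (mu p)) : ℝ≥0∞ :=
  (∫⁻ χ, ENNReal.ofReal (w χ ^ 2 * ‖fhat f χ‖ ^ 2) ∂(nu p)) ^ (1 / 2 : ℝ)

end PadicFrame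

end

/-! On the Fourier side the partial sum of the wavelet series is simply restriction to a set of
frequencies. The mask equation says that the Fourier transform of `ψ_j` is the indicator of `E_j`,
so that of `ψ_{n,h}^{(j)}` is the exponential `p^{-n/2} conj (χ, 𝒜^{-n} h)` cut off to `E_j 𝒜^n`.
Since `s(j) ≥ 0`, this set lies in one coset of `G_n^⊥`, on which these exponentials, for `h ∈ H_0`,
form an orthonormal basis. Cutting an orthonormal basis off to a subset leaves a Parseval frame of
the subset, hence `∑_h |⟨f, ψ_{n,h}^{(j)}⟩|² = ∫_{E_j 𝒜^n} |f̂|²` (`tsum_enorm_inner_ψL2`).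

The tiling of one annulus makes all the sets `E_j 𝒜^n` disjoint (`disjoint_dilE`). So the
coefficients with `n ≤ K` carry exactly the energy of `f̂` on the union `cover K`, and an abstract
argument on families satisfying Bessel's inequality (`hasSum_inner_smul_of_bessel`) turns this
identity into unconditional convergence to the part of `f` with frequencies in `cover K`
(`exists_hasSum_term`). The squared error is therefore `∫ |f̂|²` off `cover K` (`err_eq_lintegral`).

A character off `cover K` has level at least `M + K + 2 - l` (`level_of_notMem_cover`), so a
Chebyshev argument (`err_le`) bounds the error by `C` times the weighted norm as soon as `C c ≥ 1`,
where `c` bounds the weight from below there. The constants of the theorem exceed `1 / c`; this is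
elementary and uses `M ≥ 1` only to make `(N+1) p^{(M-1)/2}` at least `1`.

The Fourier analysis is built by hand: wave packets give Hilbert bases of `L₂(ℚ_p)` and `L₂(X)`, the
unitary operator matching them at scale `0` is the Plancherel transform, and it is identified with
the `L₂`-limit that defines `fhat`. -/

namespace PadicFrame

/-! ### Balls of `ℚ_p`, characters and annihilators. -/

section Geometry

variable {p : ℕ} [Fact p.Prime]

theorem one_lt_p (p : ℕ) [Fact p.Prime] : (1 : ℝ) < p := by
  exact_mod_cast (Fact.out : p.Prime).one_lt

theorem mem_ball_iff {n : ℤ} {x : ℚ_[p]} : x ∈ ball p n ↔ ‖x‖ ≤ (p : ℝ) ^ (-n) := Iff.rfl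

theorem zero_mem_ball (n : ℤ) : (0 : ℚ_[p]) ∈ ball p n := by
  simp [mem_ball_iff, (zpow_p_pos p n).le]

theorem add_mem_ball {n : ℤ} {x y : ℚ_[p]} (hx : x ∈ ball p n) (hy : y ∈ ball p n) :
    x + y ∈ ball p n :=
  (Padic.nonarchimedean x y).trans (max_le hx hy)

theorem neg_mem_ball {n : ℤ} {x : ℚ_[p]} (hx : x ∈ ball p n) : -x ∈ ball p n := by
  simpa [mem_ball_iff] using hx

theorem sub_mem_ball {n : ℤ} {x y : ℚ_[p]} (hx : x ∈ ball p n) (hy : y ∈ ball p n) :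
    x - y ∈ ball p n := by
  simpa [sub_eq_add_neg] using add_mem_ball hx (neg_mem_ball hy)

theorem ball_subset_ball {m n : ℤ} (h : m ≤ n) : ball p n ⊆ ball p m := fun _ hx =>
  le_trans hx (zpow_le_zpow_right₀ (one_lt_p p).le (neg_le_neg h))

theorem isOpen_ball (n : ℤ) : IsOpen (ball p n) := by
  rw [ball_eq]; exact IsUltrametricDist.isOpen_closedBall _ (zpow_p_pos p _).ne'

theorem isCompact_ball (n : ℤ) : IsCompact (ball p n) := by
  rw [ball_eq]; exact isCompact_closedBall _ _

theorem measurableSet_ball (n : ℤ) : MeasurableSet (ball p n) := (isOpen_ball n).measurableSet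

theorem exists_mem_ball (x : ℚ_[p]) : ∃ k : ℕ, x ∈ ball p (-(k : ℤ)) := by
  obtain ⟨k, hk⟩ := pow_unbounded_of_one_lt ‖x‖ (one_lt_p p)
  exact ⟨k, by simpa [mem_ball_iff] using hk.le⟩

theorem exists_ball_subset {U : Set ℚ_[p]} (hU : U ∈ 𝓝 (0 : ℚ_[p])) :
    ∃ k : ℕ, ball p (k : ℤ) ⊆ U := by
  obtain ⟨ε, hε, h⟩ := Metric.mem_nhds_iff.1 hU
  obtain ⟨k, hk⟩ := exists_pow_lt_of_lt_one hε (inv_lt_one_of_one_lt₀ (one_lt_p p))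
  refine ⟨k, fun x hx => h ?_⟩
  rw [mem_ball_zero_iff]
  refine lt_of_le_of_lt hx ?_
  simpa using hk

theorem p_ne_zero (p : ℕ) [Fact p.Prime] : (p : ℚ_[p]) ≠ 0 := by
  exact_mod_cast (Fact.out : p.Prime).ne_zero

theorem dil_mem_ball {k n : ℤ} {x : ℚ_[p]} : dil p k x ∈ ball p n ↔ x ∈ ball p (n + k) := by
  simp only [mem_ball_iff, dil, norm_mul, Padic.norm_p_zpow, neg_neg]
  rw [neg_add, zpow_add₀ (by exact_mod_cast (Fact.out : p.Prime).ne_zero), mul_comm,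
    zpow_neg (p : ℝ) k, ← div_eq_mul_inv, le_div_iff₀ (zpow_p_pos p k)]

theorem dil_dil (a b : ℤ) (x : ℚ_[p]) : dil p a (dil p b x) = dil p (a + b) x := by
  simp only [dil, neg_add, zpow_add₀ (p_ne_zero p)]; ring

@[simp] theorem dil_zero_left (x : ℚ_[p]) : dil p 0 x = x := by simp [dil]

theorem dil_add (n : ℤ) (x y : ℚ_[p]) : dil p n (x + y) = dil p n x + dil p n y := by
  simp [dil, mul_add]

theorem dil_sub (n : ℤ) (x y : ℚ_[p]) : dil p n (x - y) = dil p n x - dil p n y := by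
  simp [dil, mul_sub]

/-! ### Evaluation of characters -/

theorem ev_add (χ : CharGroup p) (x y : ℚ_[p]) : ev χ (x + y) = ev χ x * ev χ y := by
  simp [ev, ofAdd_add]

@[simp] theorem ev_zero (χ : CharGroup p) : ev χ 0 = 1 := by simp [ev]

@[simp] theorem norm_ev (χ : CharGroup p) (x : ℚ_[p]) : ‖ev χ x‖ = 1 := Circle.norm_coe _

theorem ev_ne_zero (χ : CharGroup p) (x : ℚ_[p]) : ev χ x ≠ 0 := by
  rw [← norm_ne_zero_iff]; simp

theorem ev_neg (χ : CharGroup p) (x : ℚ_[p]) : ev χ (-x) = conj (ev χ x) := by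
  rw [ev, ofAdd_neg, map_inv, Circle.coe_inv_eq_conj]; rfl

theorem ev_sub (χ : CharGroup p) (x y : ℚ_[p]) : ev χ (x - y) = ev χ x * conj (ev χ y) := by
  rw [sub_eq_add_neg, ev_add, ev_neg]

theorem ev_mul_conj (χ : CharGroup p) (x : ℚ_[p]) : ev χ x * conj (ev χ x) = 1 := by
  rw [← ev_sub]; simp

theorem ev_mul (χ η : CharGroup p) (x : ℚ_[p]) : ev (χ * η) x = ev χ x * ev η x := by
  simp only [ev, ← Circle.coe_mul]; rfl

@[simp] theorem ev_one (x : ℚ_[p]) : ev (1 : CharGroup p) x = 1 := by simp [ev]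

theorem ev_inv (χ : CharGroup p) (x : ℚ_[p]) : ev χ⁻¹ x = conj (ev χ x) := by
  have h : ev χ⁻¹ x * ev χ x = 1 := by rw [← ev_mul]; simp
  have h' : conj (ev χ x) * ev χ x = 1 := by rw [mul_comm]; exact ev_mul_conj χ x
  exact mul_right_cancel₀ (ev_ne_zero χ x) (h.trans h'.symm)

theorem ext_ev {χ η : CharGroup p} (h : ∀ x, ev χ x = ev η x) : χ = η :=
  PontryaginDual.ext fun a => Circle.ext (h a.toAdd)

theorem continuous_ev_uncurry : Continuous fun z : CharGroup p × ℚ_[p] => ev z.1 z.2 := by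
  have h1 : Continuous fun χ : CharGroup p =>
      (ContinuousMonoidHom.toContinuousMap χ : C(Multiplicative ℚ_[p], Circle)) :=
    continuous_induced_dom
  have h2 : Continuous fun z : C(Multiplicative ℚ_[p], Circle) × Multiplicative ℚ_[p] =>
      z.1 z.2 := continuous_eval
  exact continuous_subtype_val.comp (h2.comp
    ((h1.comp continuous_fst).prodMk (continuous_ofAdd.comp continuous_snd)))

theorem continuous_ev (χ : CharGroup p) : Continuous (ev χ) :=
  continuous_ev_uncurry.comp (continuous_const.prodMk continuous_id)

theorem continuous_ev_left (x : ℚ_[p]) : Continuous fun χ : CharGroup p => ev χ x :=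
  continuous_ev_uncurry.comp (continuous_id.prodMk continuous_const)

/-! ### Annihilators -/

variable (p) in
/-- `G_n^⊥` as a subgroup. -/
def annihSub (n : ℤ) : Subgroup (CharGroup p) where
  carrier := annih p n
  one_mem' := fun x _ => by simp
  mul_mem' := fun {a b} ha hb x hx => by rw [ev_mul, ha x hx, hb x hx, one_mul]
  inv_mem' := fun {a} ha x hx => by rw [ev_inv, ha x hx, map_one]

theorem one_mem_annih (n : ℤ) : (1 : CharGroup p) ∈ annih p n := (annihSub p n).one_mem

theorem mul_mem_annih {n : ℤ} {χ η : CharGroup p} (h : χ ∈ annih p n) (h' : η ∈ annih p n) :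
    χ * η ∈ annih p n := (annihSub p n).mul_mem h h'

theorem inv_mem_annih {n : ℤ} {χ : CharGroup p} (h : χ ∈ annih p n) : χ⁻¹ ∈ annih p n :=
  (annihSub p n).inv_mem h

theorem annih_mono {m n : ℤ} (h : m ≤ n) : annih p m ⊆ annih p n := fun _ hχ x hx =>
  hχ x (ball_subset_ball h hx)

theorem eq_one_of_forall_mem_annih {χ : CharGroup p} (h : ∀ k : ℕ, χ ∈ annih p (-(k : ℤ))) :
    χ = 1 := ext_ev fun x => by
  obtain ⟨k, hk⟩ := exists_mem_ball x
  rw [h k x hk, ev_one]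

/-- The circle has no nontrivial subgroup in an open half-circle, and `G_n` is stable under integer
multiples. This form exhibits the annihilator as open in the compact-open topology. -/
theorem annih_eq_mapsTo (n : ℤ) : annih p n =
    {χ : CharGroup p | Set.MapsTo χ (Multiplicative.toAdd ⁻¹' ball p n)
      (Circle.centeredArc (Real.pi / 2))} := by
  ext χ
  constructor
  · intro h x hx
    have : χ x = 1 := Circle.ext (h x.toAdd hx)
    rw [this, Circle.mem_centeredArc (by linarith [Real.pi_pos])]
    simp [Real.pi_pos]
  · intro h x hx
    have : χ (Multiplicative.ofAdd x) = 1 := by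
      refine Circle.eq_one_of_forall_pow_mem_centeredArc_pi_div_two fun k _ => ?_
      rw [← map_pow]
      refine h ?_
      change k • x ∈ ball p n
      rw [mem_ball_iff, nsmul_eq_mul, norm_mul]
      refine le_trans (mul_le_of_le_one_left (norm_nonneg _) ?_) hx
      simpa using Padic.norm_int_le_one (p := p) (k : ℤ)
    simp [ev, this]

theorem isOpen_annih (n : ℤ) : IsOpen (annih p n) := by
  rw [annih_eq_mapsTo]
  exact isOpen_induced (ContinuousMap.isOpen_setOfPred_mapsTo
    (Homeomorph.isCompact_preimage (Homeomorph.refl (Multiplicative ℚ_[p])) |>.2 (isCompact_ball n))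
    (Circle.isOpen_centeredArc (Real.pi / 2)))

theorem isClosed_annih (n : ℤ) : IsClosed (annih p n) :=
  (annihSub p n).isClosed_of_isOpen (isOpen_annih n)

theorem measurableSet_annih (n : ℤ) : MeasurableSet (annih p n) := (isOpen_annih n).measurableSet

theorem iUnion_annih : ⋃ k : ℕ, annih p (k : ℤ) = Set.univ := by
  refine Set.eq_univ_of_forall fun χ => Set.mem_iUnion.2 ?_
  have hc : Continuous fun x : ℚ_[p] => χ (Multiplicative.ofAdd x) :=
    (map_continuous χ).comp continuous_ofAdd
  have : (fun x : ℚ_[p] => χ (Multiplicative.ofAdd x)) ⁻¹' Circle.centeredArc (Real.pi / 2) ∈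
      𝓝 (0 : ℚ_[p]) := by
    refine ((Circle.isOpen_centeredArc _).preimage hc).mem_nhds ?_
    simp only [Set.mem_preimage, ofAdd_zero, map_one]
    rw [Circle.mem_centeredArc (by linarith [Real.pi_pos])]
    simp [Real.pi_pos]
  obtain ⟨k, hk⟩ := exists_ball_subset this
  refine ⟨k, ?_⟩
  rw [annih_eq_mapsTo]
  exact fun x hx => hk hx

variable (p) in
/-- `G_n` as a subgroup. -/
def ballSub (n : ℤ) : Subgroup (Multiplicative ℚ_[p]) where
  carrier := Multiplicative.toAdd ⁻¹' ball p n
  one_mem' := zero_mem_ball n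
  mul_mem' := add_mem_ball
  inv_mem' := neg_mem_ball

instance discreteTopology_quotient_ballSub (n : ℤ) :
    DiscreteTopology (Multiplicative ℚ_[p] ⧸ ballSub p n) :=
  QuotientGroup.discreteTopology ((isOpen_ball n).preimage continuous_toAdd)

/-- The projection onto `ℚ_p / G_n`. -/
noncomputable def quotHom (p : ℕ) [Fact p.Prime] (n : ℤ) :
    Multiplicative ℚ_[p] →ₜ* (Multiplicative ℚ_[p] ⧸ ballSub p n) where
  toMonoidHom := QuotientGroup.mk' (ballSub p n)
  continuous_toFun := QuotientGroup.continuous_mk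

/-- A character trivial on `G_n` factors through the discrete group `ℚ_p / G_n`, whose dual is
compact; this is the source of compactness of the annihilators. -/
theorem annih_eq_range (n : ℤ) :
    annih p n = Set.range (PontryaginDual.map (quotHom p n)) := by
  ext χ
  constructor
  · intro h
    refine ⟨⟨QuotientGroup.lift (ballSub p n) (χ : Multiplicative ℚ_[p] →* Circle) ?_,
      continuous_of_discreteTopology⟩, ?_⟩
    · intro x hx
      exact Circle.ext (h x.toAdd hx)
    · exact PontryaginDual.ext fun x => rfl
  · rintro ⟨η, rfl⟩ x hx
    have : (quotHom p n) (Multiplicative.ofAdd x) = 1 := (QuotientGroup.eq_one_iff _).2 hx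
    change ((η ((quotHom p n) (Multiplicative.ofAdd x)) : Circle) : ℂ) = 1
    simp [this]

theorem isCompact_annih (n : ℤ) : IsCompact (annih p n) := by
  rw [annih_eq_range]; exact isCompact_range (map_continuous _)

/-- The embedding of `ℚ / ℤ` into the circle. -/
noncomputable def ratCircleHom : AddCircle (1 : ℚ) →+ Additive Circle :=
  QuotientAddGroup.lift (AddSubgroup.zmultiples (1 : ℚ))
    { toFun := fun q => Additive.ofMul (Circle.exp (2 * Real.pi * (q : ℝ)))
      map_zero' := by simp
      map_add' := fun a b => by
        rw [← ofMul_mul, ← Circle.exp_add]; push_cast; ring_nf }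
    (by
      rintro _ ⟨k, rfl⟩
      have : Circle.exp (2 * Real.pi * k) = 1 := Circle.exp_eq_one.2 ⟨k, by ring⟩
      simpa using congrArg Additive.ofMul this)

theorem ratCircleHom_injective : Function.Injective ratCircleHom := by
  rw [injective_iff_map_eq_zero]
  intro a
  induction a using QuotientAddGroup.induction_on with
  | H q =>
    intro h
    have h1 : Circle.exp (2 * Real.pi * (q : ℝ)) = 1 := h
    obtain ⟨k, hk⟩ := Circle.exp_eq_one.1 h1
    have h2 : (q : ℝ) = k :=
      mul_left_cancel₀ (by positivity : (2 * Real.pi : ℝ) ≠ 0) (hk.trans (by ring))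
    refine (QuotientAddGroup.eq_zero_iff _).2 ⟨k, ?_⟩
    simp only [zsmul_eq_mul, mul_one]
    exact_mod_cast h2.symm

/-- Homomorphisms to `ℚ / ℤ` separate the points of any abelian group, here `ℚ_p / G_n`, and `ℚ / ℤ`
embeds in the circle. No explicit character of `ℚ_p` is needed. -/
theorem exists_mem_annih_ev_ne_one {n : ℤ} {x : ℚ_[p]} (hx : x ∉ ball p n) :
    ∃ χ ∈ annih p n, ev χ x ≠ 1 := by
  let Q := Multiplicative ℚ_[p] ⧸ ballSub p n
  let a : Additive Q := Additive.ofMul (quotHom p n (Multiplicative.ofAdd x))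
  have ha : a ≠ 0 := fun h => hx ((QuotientGroup.eq_one_iff (N := ballSub p n) _).1 h)
  obtain ⟨c, hc⟩ := CharacterModule.exists_character_apply_ne_zero_of_ne_zero ha
  let c' : Additive Q →+ AddCircle (1 : ℚ) := c
  let η : PontryaginDual Q :=
    ⟨⟨⟨fun q => (ratCircleHom (c' (Additive.ofMul q))).toMul, by simp⟩, fun q r => by simp⟩,
      continuous_of_discreteTopology⟩
  refine ⟨PontryaginDual.map (quotHom p n) η, annih_eq_range (p := p) n ▸ ⟨η, rfl⟩, fun h => hc ?_⟩
  apply ratCircleHom_injective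
  rw [map_zero]
  exact (Circle.ext h : (ratCircleHom (c a)).toMul = (1 : Circle))

/-- Compactness: the annihilators `G_{-k}^⊥` are compact, decreasing, and intersect in `{1}`. -/
theorem exists_annih_subset {U : Set (CharGroup p)} (hU : U ∈ 𝓝 (1 : CharGroup p)) :
    ∃ k : ℕ, annih p (-(k : ℤ)) ⊆ U := by
  refine exists_subset_nhds_of_isCompact' (V := fun k : ℕ => annih p (-(k : ℤ))) ?_
    (fun _ => isCompact_annih _) (fun _ => isClosed_annih _) ?_
  · exact (antitone_nat_of_succ_le fun k => annih_mono (by push_cast; lia)).directed_ge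
  · intro χ hχ
    rw [eq_one_of_forall_mem_annih (fun k => Set.mem_iInter.1 hχ k)]
    exact hU

instance : SigmaCompactSpace (CharGroup p) :=
  SigmaCompactSpace_iff_exists_compact_covering.2
    ⟨fun k => annih p (k : ℤ), fun _ => isCompact_annih _, iUnion_annih⟩

/-! ### Dilations of characters -/

theorem cdil_cdil (a b : ℤ) (χ : CharGroup p) : cdil a (cdil b χ) = cdil (a + b) χ :=
  ext_ev fun x => by simp only [ev_cdil, dil_dil, add_comm]

@[simp] theorem cdil_zero (χ : CharGroup p) : cdil 0 χ = χ := ext_ev fun x => by simp [ev_cdil]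

theorem cdil_mul (n : ℤ) (χ η : CharGroup p) : cdil n (χ * η) = cdil n χ * cdil n η := map_mul _ _ _

theorem cdil_inv (n : ℤ) (χ : CharGroup p) : cdil n χ⁻¹ = (cdil n χ)⁻¹ := map_inv _ _

@[simp] theorem cdil_one (n : ℤ) : cdil n (1 : CharGroup p) = 1 := map_one _

theorem cdil_eq_one {n : ℤ} {χ : CharGroup p} : cdil n χ = 1 ↔ χ = 1 := by
  refine ⟨fun h => ?_, fun h => by simp [h]⟩
  have := congrArg (cdil (-n)) h
  simpa [cdil_cdil] using this

theorem cdil_mem_annih {k n : ℤ} {χ : CharGroup p} : cdil k χ ∈ annih p n ↔ χ ∈ annih p (n - k) := by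
  constructor
  · intro h x hx
    have := h (dil p (-k) x) (dil_mem_ball.2 (by simpa [sub_eq_add_neg] using hx))
    simpa [ev_cdil, dil_dil] using this
  · intro h x hx
    rw [ev_cdil]
    exact h _ (dil_mem_ball.2 (by simpa using hx))

/-! ### Cosets of annihilators -/

theorem mem_coset {s : ℤ} {η χ : CharGroup p} : χ ∈ coset s η ↔ χ * η⁻¹ ∈ annih p (-s) := Iff.rfl

theorem self_mem_coset (s : ℤ) (η : CharGroup p) : η ∈ coset s η := by
  simp [mem_coset, one_mem_annih]

theorem coset_eq_of_mem {s : ℤ} {η χ : CharGroup p} (h : χ ∈ coset s η) :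
    coset s χ = coset s η := by
  ext ζ
  constructor <;> intro h'
  · simpa [mem_coset] using mul_mem_annih h' h
  · simpa [mem_coset] using mul_mem_annih h' (inv_mem_annih h)

theorem isOpen_coset (s : ℤ) (η : CharGroup p) : IsOpen (coset s η) :=
  (isOpen_annih _).preimage (continuous_mul_const _)

theorem isCompact_coset (s : ℤ) (η : CharGroup p) : IsCompact (coset s η) :=
  (Homeomorph.isCompact_preimage (Homeomorph.mulRight η⁻¹)).2 (isCompact_annih _)

theorem measurableSet_coset (s : ℤ) (η : CharGroup p) : MeasurableSet (coset s η) :=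
  (isOpen_coset s η).measurableSet

theorem coset_subset_coset {s t : ℤ} (h : s ≤ t) (η : CharGroup p) : coset t η ⊆ coset s η :=
  fun _ hχ => annih_mono (neg_le_neg h) hχ

theorem cdil_preimage_coset (n s : ℤ) (η : CharGroup p) :
    cdil (-n) ⁻¹' coset s η = coset (s - n) (cdil n η) := by
  ext χ
  have : χ * (cdil n η)⁻¹ = cdil n (cdil (-n) χ * η⁻¹) := by
    simp [cdil_mul, cdil_cdil, cdil_inv]
  rw [Set.mem_preimage, mem_coset, mem_coset, this, cdil_mem_annih]
  congr! 2
  ring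

end Geometry

end PadicFrame

namespace PadicFrame

/-! ### Haar measures of balls and annihilators, and integrals of characters. -/

section Measures

variable {p : ℕ} [Fact p.Prime]

/-! ### Haar measure on `ℚ_p` -/

theorem mu_ball_ne_top (n : ℤ) : mu p (ball p n) ≠ ∞ := (isCompact_ball n).measure_lt_top.ne

theorem mu_ball_zero : mu p (ball p 0) = 1 := Measure.addHaarMeasure_self (K₀ := unitBall p)

theorem p_pow_ne_zero (n : ℤ) : (p : ℚ_[p]) ^ n ≠ 0 := zpow_ne_zero _ (p_ne_zero p)

theorem measurable_dil (n : ℤ) : Measurable (dil p n) := (continuous_dil p n).measurable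

theorem dil_preimage_ball (k n : ℤ) : dil p k ⁻¹' ball p n = ball p (n + k) := by
  ext x; exact dil_mem_ball

/-- Haar measure is unique up to a scalar, which is read off on `G_0`. -/
theorem map_dil_mu (n : ℤ) : (mu p).map (dil p n) = mu p (ball p n) • mu p := by
  have h1 : ((mu p).map (dil p n)).IsAddHaarMeasure :=
    (AddAut.mulLeft (Units.mk0 ((p : ℚ_[p]) ^ (-n)) (p_pow_ne_zero _))).isAddHaarMeasure_map (mu p)
      (continuous_const_mul _) (continuous_const_mul _)
  have h2 := Measure.addHaarMeasure_unique ((mu p).map (dil p n)) (unitBall p)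
  rw [h2]
  change (mu p).map (dil p n) (ball p 0) • mu p = _
  rw [Measure.map_apply (measurable_dil n) (measurableSet_ball 0), dil_preimage_ball, zero_add]

theorem mu_ball_add (m n : ℤ) : mu p (ball p (m + n)) = mu p (ball p m) * mu p (ball p n) := by
  rw [← dil_preimage_ball, ← Measure.map_apply (measurable_dil n) (measurableSet_ball m),
    map_dil_mu, Measure.smul_apply, smul_eq_mul, mul_comm]

/-- The coset `h + G_n`. -/
def ballAt (n : ℤ) (h : ℚ_[p]) : Set ℚ_[p] := {x | x - h ∈ ball p n}

theorem mem_ballAt {n : ℤ} {h x : ℚ_[p]} : x ∈ ballAt n h ↔ x - h ∈ ball p n := Iff.rfl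

theorem ballAt_eq_preimage (n : ℤ) (h : ℚ_[p]) : ballAt n h = (fun x => x - h) ⁻¹' ball p n := rfl

theorem self_mem_ballAt (n : ℤ) (h : ℚ_[p]) : h ∈ ballAt n h := by
  simp [mem_ballAt, zero_mem_ball]

theorem ballAt_eq_of_mem {n : ℤ} {x h : ℚ_[p]} (hx : x ∈ ballAt n h) :
    ballAt n x = ballAt n h := by
  ext z
  constructor <;> intro h'
  · simpa [mem_ballAt] using add_mem_ball h' hx
  · simpa [mem_ballAt] using sub_mem_ball h' hx

theorem ballAt_subset_ballAt {m n : ℤ} (hmn : m ≤ n) (h : ℚ_[p]) : ballAt n h ⊆ ballAt m h :=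
  fun _ hx => ball_subset_ball hmn hx

theorem isOpen_ballAt (n : ℤ) (h : ℚ_[p]) : IsOpen (ballAt n h) :=
  (isOpen_ball n).preimage (continuous_id.sub continuous_const)

theorem isCompact_ballAt (n : ℤ) (h : ℚ_[p]) : IsCompact (ballAt n h) :=
  (Homeomorph.isCompact_preimage (Homeomorph.subRight h)).2 (isCompact_ball _)

theorem measurableSet_ballAt (n : ℤ) (h : ℚ_[p]) : MeasurableSet (ballAt n h) :=
  (isOpen_ballAt n h).measurableSet

theorem mu_ballAt (n : ℤ) (h : ℚ_[p]) : mu p (ballAt n h) = mu p (ball p n) := by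
  rw [ballAt_eq_preimage]
  simp_rw [sub_eq_add_neg]
  exact measure_preimage_add_right _ _ _

theorem disjoint_ballAt {n : ℤ} {h h' : ℚ_[p]} (hh : h - h' ∉ ball p n) :
    Disjoint (ballAt n h) (ballAt n h') := by
  rw [Set.disjoint_left]
  intro x hx hx'
  exact hh (by simpa using sub_mem_ball hx' hx)

theorem ball_zero_eq_iUnion : ball p 0 = ⋃ i ∈ Finset.range p, ballAt 1 (i : ℚ_[p]) := by
  ext x
  simp only [Set.mem_iUnion, Finset.mem_range, exists_prop, mem_ballAt]
  constructor
  · intro hx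
    have hx1 : ‖x‖ ≤ 1 := by simpa [mem_ball_iff] using hx
    obtain ⟨i, hi, h⟩ := PadicInt.exists_mem_range (⟨x, hx1⟩ : ℤ_[p])
    refine ⟨i, hi, ?_⟩
    have h' : ‖x - i‖ < 1 := PadicInt.mem_nonunits.1 ((IsLocalRing.mem_maximalIdeal _).1 h)
    rw [mem_ball_iff, Padic.norm_le_pow_iff_norm_lt_pow_add_one]
    simpa using h'
  · rintro ⟨i, hi, h⟩
    have : (i : ℚ_[p]) ∈ ball p 0 := by
      simpa [mem_ball_iff] using Padic.norm_int_le_one (p := p) (i : ℤ)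
    simpa using add_mem_ball (ball_subset_ball (by norm_num) h) this

theorem mu_ball_one : mu p (ball p 1) = (p : ℝ≥0∞)⁻¹ := by
  have h1 : mu p (ball p 0) = ∑ i ∈ Finset.range p, mu p (ballAt 1 (i : ℚ_[p])) := by
    rw [ball_zero_eq_iUnion, measure_biUnion_finset]
    · intro i hi j hj hij
      refine disjoint_ballAt fun h => hij ?_
      have h' : ‖(((i : ℤ) - j : ℤ) : ℚ_[p])‖ < 1 := by
        rw [mem_ball_iff, Padic.norm_le_pow_iff_norm_lt_pow_add_one] at h
        simpa using h
      rw [Padic.norm_intCast_lt_one_iff] at h'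
      have hi' := Finset.mem_range.1 hi
      have hj' := Finset.mem_range.1 hj
      have := Int.eq_zero_of_abs_lt_dvd h' (by rw [abs_lt]; lia)
      lia
    · exact fun i _ => measurableSet_ballAt _ _
  simp only [mu_ball_zero, mu_ballAt, Finset.sum_const, Finset.card_range, nsmul_eq_mul] at h1
  exact ENNReal.eq_inv_of_mul_eq_one_left (by rw [mul_comm]; exact h1.symm)

theorem mu_real_ball (n : ℤ) : (mu p).real (ball p n) = (p : ℝ) ^ (-n) := by
  have h1 : (mu p).real (ball p 1) = (p : ℝ)⁻¹ := by simp [measureReal_def, mu_ball_one]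
  have hadd (m n : ℤ) :
      (mu p).real (ball p (m + n)) = (mu p).real (ball p m) * (mu p).real (ball p n) := by
    simp [measureReal_def, mu_ball_add]
  have hp : (p : ℝ) ≠ 0 := by have := one_lt_p p; positivity
  induction n using Int.induction_on with
  | zero => simp [measureReal_def, mu_ball_zero]
  | succ n ih => rw [hadd, ih, h1, neg_add, zpow_add₀ hp, zpow_neg_one]
  | pred n ih =>
    have h2 := hadd (-(n : ℤ) - 1) 1
    rw [sub_add_cancel, ih, h1] at h2
    rw [eq_mul_inv_iff_mul_eq₀ hp] at h2
    rw [← h2, neg_sub, sub_neg_eq_add, add_comm, zpow_add₀ hp, zpow_one, neg_neg]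

/-! ### Integrals of characters over balls -/

/-- If `χ` is nontrivial on `G_n`, translating by some `y ∈ G_n` with `(χ, y) ≠ 1` multiplies the
integral by `(χ, y)`, so it vanishes. -/
theorem integral_ball_ev (n : ℤ) (χ : CharGroup p) :
    ∫ x in ball p n, ev χ x ∂(mu p) = (annih p n).indicator (fun _ => ((p : ℂ) ^ (-n))) χ := by
  by_cases h : χ ∈ annih p n
  · rw [Set.indicator_of_mem h, setIntegral_congr_fun (g := fun _ => (1 : ℂ)) (measurableSet_ball n)
      (fun x hx => h x hx)]
    simp [mu_real_ball]
  · rw [Set.indicator_of_notMem h]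
    obtain ⟨y, hy, hne⟩ : ∃ y ∈ ball p n, ev χ y ≠ 1 := by simpa [annih] using h
    have key : ∫ x in ball p n, ev χ x ∂(mu p) = ev χ y * ∫ x in ball p n, ev χ x ∂(mu p) := by
      rw [← integral_const_mul, ← integral_indicator (measurableSet_ball n),
        ← integral_indicator (measurableSet_ball n),
        ← integral_add_right_eq_self _ y]
      refine integral_congr_ae (ae_of_all _ fun x => ?_)
      have hx : x + y ∈ ball p n ↔ x ∈ ball p n :=
        ⟨fun h => by simpa using sub_mem_ball h hy, fun h => add_mem_ball h hy⟩
      by_cases h1 : x ∈ ball p n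
      · simp [h1, hx.2 h1, ev_add, mul_comm]
      · simp [h1, mt hx.1 h1]
    have : (1 - ev χ y) * ∫ x in ball p n, ev χ x ∂(mu p) = 0 := by
      rw [sub_mul, one_mul, ← key, sub_self]
    exact (mul_eq_zero.1 this).resolve_left (sub_ne_zero.2 (Ne.symm hne))

/-! ### Haar measure on the dual group -/

theorem haar_annih_ne_zero (n : ℤ) : (Measure.haar : Measure (CharGroup p)) (annih p n) ≠ 0 :=
  ((isOpen_annih n).measure_pos _ ⟨1, one_mem_annih n⟩).ne'

theorem haar_annih_ne_top (n : ℤ) : (Measure.haar : Measure (CharGroup p)) (annih p n) ≠ ∞ :=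
  (isCompact_annih n).measure_lt_top.ne

instance instIsHaarMeasureNu : (nu p).IsHaarMeasure :=
  Measure.IsHaarMeasure.smul _ (ENNReal.inv_ne_zero.2 (haar_annih_ne_top 0))
    (ENNReal.inv_ne_top.2 (haar_annih_ne_zero 0))

theorem nu_annih_zero : nu p (annih p 0) = 1 := by
  rw [nu, Measure.smul_apply, smul_eq_mul,
    ENNReal.inv_mul_cancel (haar_annih_ne_zero 0) (haar_annih_ne_top 0)]

theorem integral_annih_ev_aux (n : ℤ) (x : ℚ_[p]) :
    ∫ χ in annih p n, ev χ x ∂(nu p) =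
      (ball p n).indicator (fun _ => ((nu p).real (annih p n) : ℂ)) x := by
  by_cases h : x ∈ ball p n
  · rw [Set.indicator_of_mem h, setIntegral_congr_fun (g := fun _ => (1 : ℂ))
      (measurableSet_annih n) (fun χ hχ => hχ x h)]
    simp
  · rw [Set.indicator_of_notMem h]
    obtain ⟨η, hη, hne⟩ := exists_mem_annih_ev_ne_one h
    have key : ∫ χ in annih p n, ev χ x ∂(nu p) = ev η x * ∫ χ in annih p n, ev χ x ∂(nu p) := by
      rw [← integral_const_mul, ← integral_indicator (measurableSet_annih n),
        ← integral_indicator (measurableSet_annih n),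
        ← integral_mul_right_eq_self _ η]
      refine integral_congr_ae (ae_of_all _ fun χ => ?_)
      have hx : χ * η ∈ annih p n ↔ χ ∈ annih p n := (annihSub p n).mul_mem_cancel_right hη
      by_cases h1 : χ ∈ annih p n
      · beta_reduce; rw [Set.indicator_of_mem h1, Set.indicator_of_mem (hx.2 h1), ev_mul, mul_comm]
      · simp [h1, mt hx.1 h1]
    have : (1 - ev η x) * ∫ χ in annih p n, ev χ x ∂(nu p) = 0 := by
      rw [sub_mul, one_mul, ← key, sub_self]
    exact (mul_eq_zero.1 this).resolve_left (sub_ne_zero.2 (Ne.symm hne))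

instance isFiniteMeasure_mu_ball (n : ℤ) : IsFiniteMeasure ((mu p).restrict (ball p n)) :=
  isFiniteMeasure_restrict.2 (mu_ball_ne_top n)

theorem nu_coset_ne_top (s : ℤ) (η : CharGroup p) : nu p (coset s η) ≠ ∞ :=
  (isCompact_coset s η).measure_lt_top.ne

instance isFiniteMeasure_nu_annih (n : ℤ) : IsFiniteMeasure ((nu p).restrict (annih p n)) :=
  isFiniteMeasure_restrict.2 (isCompact_annih n).measure_lt_top.ne

/-- Fubini for integrands `f(χ) g(x) (χ, x)`, for a phase `ev` of modulus one. -/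
theorem integral_ev_swap {α : Measure (CharGroup p)} {β : Measure ℚ_[p]} [SFinite α] [SFinite β]
    {f : CharGroup p → ℂ} {g : ℚ_[p] → ℂ} (hf : Integrable f α) (hg : Integrable g β) :
    ∫ χ, ∫ x, f χ * g x * ev χ x ∂β ∂α = ∫ x, ∫ χ, f χ * g x * ev χ x ∂α ∂β := by
  refine integral_integral_swap ?_
  refine (hf.mul_prod hg).mul_bdd (c := 1) continuous_ev_uncurry.aestronglyMeasurable
    (ae_of_all _ fun z => (norm_ev z.1 z.2).le)

/-- The integral of `(χ, x)` over `G_n^⊥ × G_k`, computed in both orders. -/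
theorem nu_real_annih_aux {k n : ℤ} (hkn : k ≤ n) :
    (p : ℂ) ^ (-k) * (nu p).real (annih p k) = (p : ℂ) ^ (-n) * (nu p).real (annih p n) := by
  have h := integral_ev_swap (p := p) (α := (nu p).restrict (annih p n))
    (β := (mu p).restrict (ball p k)) (integrable_const 1) (integrable_const 1)
  simp only [one_mul, integral_ball_ev, integral_annih_ev_aux] at h
  rw [setIntegral_indicator (measurableSet_annih k), setIntegral_indicator (measurableSet_ball n),
    Set.inter_eq_right.2 (annih_mono hkn), Set.inter_eq_right.2 (ball_subset_ball hkn)] at h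
  simp only [integral_const, MeasurableSet.univ, measureReal_restrict_apply, Set.univ_inter,
    mu_real_ball, Complex.real_smul] at h
  rw [mul_comm, h]
  push_cast
  rfl

theorem p_complex_ne_zero (p : ℕ) [Fact p.Prime] : (p : ℂ) ≠ 0 := by
  exact_mod_cast (Fact.out : p.Prime).ne_zero

theorem nu_real_annih (n : ℤ) : (nu p).real (annih p n) = (p : ℝ) ^ n := by
  have h : (p : ℂ) ^ (-n) * (nu p).real (annih p n) = 1 := by
    have h0 : (p : ℂ) ^ (-(0 : ℤ)) * (nu p).real (annih p 0) = 1 := by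
      simp [measureReal_def, nu_annih_zero]
    rcases le_total n 0 with hn | hn
    · rw [nu_real_annih_aux hn, h0]
    · rw [← nu_real_annih_aux hn, h0]
  have h' : (((nu p).real (annih p n) : ℝ) : ℂ) = (((p : ℝ) ^ n : ℝ) : ℂ) := by
    rw [zpow_neg, inv_mul_eq_one₀ (zpow_ne_zero _ (p_complex_ne_zero p))] at h
    rw [← h]; push_cast; rfl
  exact_mod_cast h'

theorem integral_annih_ev (n : ℤ) (x : ℚ_[p]) :
    ∫ χ in annih p n, ev χ x ∂(nu p) = (ball p n).indicator (fun _ => (p : ℂ) ^ n) x := by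
  rw [integral_annih_ev_aux, nu_real_annih]; push_cast; rfl

theorem integral_coset_ev (n : ℤ) (η : CharGroup p) (x : ℚ_[p]) :
    ∫ χ in coset (-n) η, ev χ x ∂(nu p) =
      (ball p n).indicator (fun _ => (p : ℂ) ^ n * ev η x) x := by
  have : ∫ χ in coset (-n) η, ev χ x ∂(nu p) = ev η x * ∫ χ in annih p n, ev χ x ∂(nu p) := by
    rw [← integral_const_mul, ← integral_indicator (measurableSet_annih n),
      ← integral_indicator (measurableSet_coset _ _), ← integral_mul_right_eq_self _ η]
    refine integral_congr_ae (ae_of_all _ fun χ => ?_)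
    have : χ * η ∈ coset (-n) η ↔ χ ∈ annih p n := by simp [mem_coset]
    by_cases h1 : χ ∈ annih p n
    · beta_reduce; rw [Set.indicator_of_mem h1, Set.indicator_of_mem (this.2 h1), ev_mul, mul_comm]
    · simp [h1, mt this.1 h1]
  rw [this, integral_annih_ev]
  by_cases h : x ∈ ball p n <;> simp [h, mul_comm]

theorem integral_ballAt_ev (n : ℤ) (h : ℚ_[p]) (χ : CharGroup p) :
    ∫ x in ballAt n h, ev χ x ∂(mu p) =
      (annih p n).indicator (fun _ => (p : ℂ) ^ (-n) * ev χ h) χ := by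
  have : ∫ x in ballAt n h, ev χ x ∂(mu p) = ev χ h * ∫ x in ball p n, ev χ x ∂(mu p) := by
    rw [← integral_const_mul, ← integral_indicator (measurableSet_ball n),
      ← integral_indicator (measurableSet_ballAt _ _), ← integral_add_right_eq_self _ h]
    refine integral_congr_ae (ae_of_all _ fun x => ?_)
    have : x + h ∈ ballAt n h ↔ x ∈ ball p n := by simp [mem_ballAt]
    by_cases h1 : x ∈ ball p n
    · simp [h1, this.2 h1, ev_add, mul_comm]
    · simp [h1, mt this.1 h1]
  rw [this, integral_ball_ev]
  by_cases hχ : χ ∈ annih p n <;> simp [hχ, mul_comm]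

theorem nu_singleton_one : nu p {1} = 0 := by
  have h (k : ℕ) : (nu p).real {1} ≤ ((p : ℝ)⁻¹) ^ k := by
    refine (measureReal_mono (Set.singleton_subset_iff.2 (one_mem_annih (-(k : ℤ))))
      (isCompact_annih _).measure_lt_top.ne).trans ?_
    rw [nu_real_annih]; simp
  have h0 : (nu p).real {1} ≤ 0 := ge_of_tendsto'
    (tendsto_pow_atTop_nhds_zero_of_lt_one (by positivity) (inv_lt_one_of_one_lt₀ (one_lt_p p))) h
  have := le_antisymm h0 measureReal_nonneg
  rwa [measureReal_eq_zero_iff isCompact_singleton.measure_lt_top.ne] at this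

end Measures

end PadicFrame

namespace PadicFrame

/-! ### Vanishing criteria for locally integrable functions. -/

section Density

/-- A locally integrable function whose integrals over the classes of a refining sequence of
partitions into compact open sets vanish is zero almost everywhere. -/
theorem ae_eq_zero_of_forall_setIntegral_class_eq_zero {Y : Type*} [TopologicalSpace Y] [T2Space Y]
    [SigmaCompactSpace Y] [MeasurableSpace Y] [BorelSpace Y] {μ : Measure Y} {F : Y → ℂ}
    (hF : LocallyIntegrable F μ) (P : ℕ → Y → Set Y) (hopen : ∀ n y, IsOpen (P n y))
    (hcompact : ∀ n y, IsCompact (P n y)) (hself : ∀ n y, y ∈ P n y)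
    (heq : ∀ n y z, z ∈ P n y → P n z = P n y) (hanti : ∀ y, Antitone fun n => P n y)
    (hbasis : ∀ y, ∀ U ∈ 𝓝 y, ∃ n, P n y ⊆ U) (h0 : ∀ n y, ∫ x in P n y, F x ∂μ = 0) :
    F =ᵐ[μ] 0 := by
  classical
  refine ae_eq_zero_of_forall_setIntegral_isCompact_eq_zero' hF fun K hK => ?_
  -- `V n` is the union of the classes meeting `K`: a finite disjoint union, so `F` has integral
  -- zero over it. These sets decrease to `K`.
  let V : ℕ → Set Y := fun n => ⋃ y ∈ K, P n y
  have hV (n : ℕ) : ∃ t : Finset (Set Y), (∀ s ∈ t, ∃ y, s = P n y) ∧ V n = ⋃ s ∈ t, s := by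
    obtain ⟨t, htK, ht⟩ := hK.elim_nhds_subcover (P n) fun y _ => (hopen n y).mem_nhds (hself n y)
    refine ⟨t.image (P n), fun s hs => ?_, ?_⟩
    · obtain ⟨y, -, rfl⟩ := Finset.mem_image.1 hs
      exact ⟨y, rfl⟩
    · ext z
      simp only [V, Set.mem_iUnion, Finset.mem_image, exists_prop, exists_exists_and_eq_and]
      constructor
      · rintro ⟨y, hy, hz⟩
        obtain ⟨w, hw, hyw⟩ := Set.mem_iUnion₂.1 (ht hy)
        exact ⟨w, hw, heq n w y hyw ▸ hz⟩
      · rintro ⟨y, hy, hz⟩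
        exact ⟨y, htK y hy, hz⟩
  have hVcompact (n : ℕ) : IsCompact (V n) := by
    obtain ⟨t, ht, hVt⟩ := hV n
    rw [hVt]
    refine t.isCompact_biUnion fun s hs => ?_
    obtain ⟨y, rfl⟩ := ht s hs
    exact hcompact n y
  have hVzero (n : ℕ) : ∫ x in V n, F x ∂μ = 0 := by
    obtain ⟨t, ht, hVt⟩ := hV n
    rw [hVt, integral_biUnion_finset (s := fun s => s)]
    · refine Finset.sum_eq_zero fun s hs => ?_
      obtain ⟨y, rfl⟩ := ht s hs
      exact h0 n y
    · intro s hs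
      obtain ⟨y, rfl⟩ := ht s hs
      exact (hopen n y).measurableSet
    · intro s hs s' hs' hne
      obtain ⟨y, rfl⟩ := ht s hs
      obtain ⟨y', rfl⟩ := ht s' hs'
      refine Set.disjoint_left.2 fun z hz hz' => hne ?_
      rw [← heq n y z hz, ← heq n y' z hz']
    · intro s hs
      obtain ⟨y, rfl⟩ := ht s hs
      exact hF.integrableOn_isCompact (hcompact n y)
  have hVK : ⋂ n, V n = K := by
    refine Set.Subset.antisymm (fun z hz => ?_) fun z hz =>
      Set.mem_iInter.2 fun n => Set.mem_biUnion hz (hself n z)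
    refine hK.isClosed.closure_subset (mem_closure_iff_nhds.2 fun U hU => ?_)
    obtain ⟨n, hn⟩ := hbasis z U hU
    obtain ⟨y, hy, hzy⟩ := Set.mem_iUnion₂.1 (Set.mem_iInter.1 hz n)
    exact ⟨y, hn (heq n y z hzy ▸ hself n y), hy⟩
  have hlim := tendsto_setIntegral_of_antitone (μ := μ) (f := F) (s := V)
    (fun n => (hVcompact n).measurableSet)
    (fun m n hmn => Set.biUnion_mono subset_rfl fun y _ => hanti y hmn)
    ⟨0, hF.integrableOn_isCompact (hVcompact 0)⟩
  simp only [hVzero, hVK] at hlim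
  exact tendsto_nhds_unique hlim tendsto_const_nhds

variable {p : ℕ} [Fact p.Prime]

theorem ae_eq_zero_of_forall_ballAt {f : ℚ_[p] → ℂ} (hf : LocallyIntegrable f (mu p)) (m : ℤ)
    (h0 : ∀ n, m ≤ n → ∀ h, ∫ x in ballAt n h, f x ∂(mu p) = 0) : f =ᵐ[mu p] 0 := by
  refine ae_eq_zero_of_forall_setIntegral_class_eq_zero hf (fun k => ballAt (m + k))
    (fun _ _ => isOpen_ballAt _ _) (fun _ _ => isCompact_ballAt _ _)
    (fun _ _ => self_mem_ballAt _ _) (fun _ _ _ h => ballAt_eq_of_mem h)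
    (fun y i j hij => ballAt_subset_ballAt (by lia) y) (fun y U hU => ?_)
    (fun k h => h0 _ (by lia) h)
  have hU' : (fun x => x + y) ⁻¹' U ∈ 𝓝 (0 : ℚ_[p]) :=
    (continuous_add_const y).continuousAt.preimage_mem_nhds (by simpa using hU)
  obtain ⟨k, hk⟩ := exists_ball_subset hU'
  refine ⟨(k - m).toNat, fun x hx => ?_⟩
  simpa using hk (ball_subset_ball (by lia) hx)

theorem ae_eq_zero_of_forall_coset {F : CharGroup p → ℂ} (hF : LocallyIntegrable F (nu p)) (m : ℤ)
    (h0 : ∀ n, n ≤ m → ∀ η, ∫ χ in coset (-n) η, F χ ∂(nu p) = 0) : F =ᵐ[nu p] 0 := by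
  refine ae_eq_zero_of_forall_setIntegral_class_eq_zero hF (fun k => coset (-(m - k)))
    (fun _ _ => isOpen_coset _ _) (fun _ _ => isCompact_coset _ _)
    (fun _ _ => self_mem_coset _ _) (fun _ _ _ h => coset_eq_of_mem h)
    (fun y i j hij => coset_subset_coset (by lia) y) (fun y U hU => ?_)
    (fun k h => h0 _ (by lia) h)
  have hU' : (fun x => x * y) ⁻¹' U ∈ 𝓝 (1 : CharGroup p) :=
    (continuous_mul_const y).continuousAt.preimage_mem_nhds (by simpa using hU)
  obtain ⟨k, hk⟩ := exists_annih_subset hU'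
  refine ⟨(k + m).toNat, fun x hx => ?_⟩
  simpa using hk (annih_mono (by lia) hx)

/-- A locally integrable function on `ℚ_p` orthogonal to all `χ · 1_{h + G_n}` vanishes. -/
theorem ae_eq_zero_of_forall_ballAt_ev {f : ℚ_[p] → ℂ} (hf : LocallyIntegrable f (mu p)) (n : ℤ)
    (h0 : ∀ h χ, ∫ x in ballAt n h, f x * ev χ x ∂(mu p) = 0) : f =ᵐ[mu p] 0 := by
  refine ae_eq_zero_of_forall_ballAt hf n fun k hk y => ?_
  have hfy : Integrable f ((mu p).restrict (ballAt n y)) :=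
    hf.integrableOn_isCompact (isCompact_ballAt n y)
  -- Averaging the hypothesis over `χ ∈ G_k^⊥` with phase `(χ, -y)` produces `p^k` times the
  -- indicator of `y + G_k`, which localises the integral to this finer coset.
  have h := integral_ev_swap (p := p) (α := (nu p).restrict (annih p k))
    (β := (mu p).restrict (ballAt n y)) (f := fun χ => ev χ (-y)) (g := f)
    (by
      refine (integrable_const (1 : ℂ)).mono (continuous_ev_left _).aestronglyMeasurable
        (ae_of_all _ fun χ => ?_)
      simp) hfy
  have hl : ∀ χ, ∫ x in ballAt n y, ev χ (-y) * f x * ev χ x ∂(mu p) = 0 := fun χ => by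
    simp only [mul_assoc]
    rw [integral_const_mul, h0, mul_zero]
  have hr : ∀ x, ∫ χ in annih p k, ev χ (-y) * f x * ev χ x ∂(nu p) =
      (ballAt k y).indicator (fun x => (p : ℂ) ^ k * f x) x := fun x => by
    have : ∀ χ : CharGroup p, ev χ (-y) * f x * ev χ x = f x * ev χ (x - y) := fun χ => by
      rw [sub_eq_add_neg, ev_add]; ring
    simp only [this]
    rw [integral_const_mul, integral_annih_ev]
    by_cases hx : x - y ∈ ball p k
    · rw [Set.indicator_of_mem hx, Set.indicator_of_mem (show x ∈ ballAt k y from hx), mul_comm]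
    · rw [Set.indicator_of_notMem hx, Set.indicator_of_notMem (show x ∉ ballAt k y from hx),
        mul_zero]
  simp only [hl, hr, integral_zero] at h
  rw [setIntegral_indicator (measurableSet_ballAt k y),
    Set.inter_eq_right.2 (ballAt_subset_ballAt hk y), integral_const_mul] at h
  exact (mul_eq_zero.1 h.symm).resolve_left (zpow_ne_zero _ (p_complex_ne_zero p))

/-- A locally integrable function on `X` orthogonal to all `ev · x · 1_{η G_n^⊥}` vanishes. -/
theorem ae_eq_zero_of_forall_coset_ev {F : CharGroup p → ℂ} (hF : LocallyIntegrable F (nu p))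
    (n : ℤ) (h0 : ∀ η x, ∫ χ in coset (-n) η, F χ * ev χ x ∂(nu p) = 0) : F =ᵐ[nu p] 0 := by
  refine ae_eq_zero_of_forall_coset hF n fun k hk η => ?_
  have hFη : Integrable F ((nu p).restrict (coset (-n) η)) :=
    hF.integrableOn_isCompact (isCompact_coset _ η)
  have h := integral_ev_swap (p := p) (α := (nu p).restrict (coset (-n) η))
    (β := (mu p).restrict (ball p k)) (f := F) (g := ev η⁻¹) hFη
    (by
      refine (integrable_const (1 : ℂ)).mono (continuous_ev _).aestronglyMeasurable
        (ae_of_all _ fun χ => ?_)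
      simp)
  have hr : ∀ x, ∫ χ in coset (-n) η, F χ * ev η⁻¹ x * ev χ x ∂(nu p) = 0 := fun x => by
    have : ∀ χ : CharGroup p, F χ * ev η⁻¹ x * ev χ x = ev η⁻¹ x * (F χ * ev χ x) := fun χ => by
      ring
    simp only [this]
    rw [integral_const_mul, h0, mul_zero]
  have hl : ∀ χ, ∫ x in ball p k, F χ * ev η⁻¹ x * ev χ x ∂(mu p) =
      (coset (-k) η).indicator (fun χ => (p : ℂ) ^ (-k) * F χ) χ := fun χ => by
    have : ∀ x : ℚ_[p], F χ * ev η⁻¹ x * ev χ x = F χ * ev (χ * η⁻¹) x := fun x => by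
      rw [ev_mul]; ring
    simp only [this]
    rw [integral_const_mul, integral_ball_ev]
    have hiff : χ ∈ coset (-k) η ↔ χ * η⁻¹ ∈ annih p k := by rw [mem_coset, neg_neg]
    by_cases hx : χ * η⁻¹ ∈ annih p k
    · rw [Set.indicator_of_mem hx, Set.indicator_of_mem (hiff.2 hx), mul_comm]
    · rw [Set.indicator_of_notMem hx, Set.indicator_of_notMem (mt hiff.1 hx), mul_zero]
  simp only [hl, hr, integral_zero] at h
  rw [setIntegral_indicator (measurableSet_coset _ η),
    Set.inter_eq_right.2 (coset_subset_coset (by lia) η), integral_const_mul] at h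
  exact (mul_eq_zero.1 h).resolve_left (zpow_ne_zero _ (p_complex_ne_zero p))

end Density

end PadicFrame

namespace PadicFrame

/-! ### `H_0` as a system of representatives of `ℚ_p / G_0`. -/

section Representatives

variable {p : ℕ} [Fact p.Prime]

/-- Base-`p` expansion of the numerator: `H_0` consists of the fractions with `p`-power denominator
in `[0, 1)`. -/
theorem mem_H0_iff {h : ℚ_[p]} :
    h ∈ H0 p ↔ ∃ s m : ℕ, m < p ^ s ∧ h = (m : ℚ_[p]) * (p : ℚ_[p]) ^ (-(s : ℤ)) := by
  have hp := p_ne_zero p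
  have hp0 := (Fact.out : p.Prime).pos
  constructor
  · rintro ⟨s, a, ha, rfl⟩
    refine ⟨s, ?_⟩
    induction s with
    | zero => exact ⟨0, by simp⟩
    | succ s ih =>
      obtain ⟨m, hm, h⟩ := ih
      refine ⟨m * p + a s, ?_, ?_⟩
      · have := ha s
        calc m * p + a s < m * p + p := by lia
          _ = (m + 1) * p := by ring
          _ ≤ p ^ s * p := Nat.mul_le_mul_right _ hm
          _ = p ^ (s + 1) := (pow_succ _ _).symm
      · rw [Finset.sum_range_succ, h]
        push_cast
        rw [neg_add, zpow_add₀ hp]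
        field_simp
  · rintro ⟨s, m, hm, rfl⟩
    suffices H : ∃ a : ℕ → ℕ, (∀ i, a i < p) ∧ (m : ℚ_[p]) * (p : ℚ_[p]) ^ (-(s : ℤ)) =
        ∑ i ∈ Finset.range s, (a i : ℚ_[p]) * (p : ℚ_[p]) ^ (-((i : ℤ) + 1)) from
      ⟨s, H⟩
    induction s generalizing m with
    | zero => exact ⟨fun _ => 0, fun _ => hp0, by simp_all⟩
    | succ s ih =>
      obtain ⟨a, ha, h⟩ := ih (m / p) (Nat.div_lt_of_lt_mul (by rwa [mul_comm, ← pow_succ]))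
      refine ⟨Function.update a s (m % p), fun i => ?_, ?_⟩
      · by_cases hi : i = s
        · subst hi; simpa using Nat.mod_lt _ hp0
        · simpa [hi] using ha i
      · rw [Finset.sum_range_succ, Finset.sum_congr rfl (g := fun i : ℕ =>
          (a i : ℚ_[p]) * (p : ℚ_[p]) ^ (-((i : ℤ) + 1)))
          (fun i hi => by rw [Function.update_of_ne (Finset.mem_range.1 hi).ne]), ← h]
        have hm' : (m : ℚ_[p]) = p * (m / p : ℕ) + (m % p : ℕ) := by
          exact_mod_cast (Nat.div_add_mod m p).symm
        simp only [Function.update_self]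
        rw [hm']
        push_cast
        rw [neg_add, zpow_add₀ hp]
        field_simp

/-- Over the common denominator `p^(s+t)`, integrality of the difference makes its numerator a
multiple of `p^(s+t)`, while its absolute value is smaller. -/
theorem eq_of_mem_H0 {h h' : ℚ_[p]} (hh : h ∈ H0 p) (hh' : h' ∈ H0 p)
    (hs : h - h' ∈ ball p 0) : h = h' := by
  have hp := p_ne_zero p
  obtain ⟨s, m, hm, rfl⟩ := mem_H0_iff.1 hh
  obtain ⟨t, n, hn, rfl⟩ := mem_H0_iff.1 hh'
  have e : (m : ℚ_[p]) * (p : ℚ_[p]) ^ (-(s : ℤ)) - n * (p : ℚ_[p]) ^ (-(t : ℤ)) =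
      ((m * p ^ t - n * p ^ s : ℤ) : ℚ_[p]) * (p : ℚ_[p]) ^ (-((s + t : ℕ) : ℤ)) := by
    push_cast
    rw [neg_add, zpow_add₀ hp]
    simp only [zpow_neg, zpow_natCast]
    field_simp
  rw [e, mem_ball_iff, norm_mul, Padic.norm_p_zpow, neg_neg, neg_zero, zpow_zero,
    ← le_div_iff₀ (zpow_p_pos p _), one_div, ← zpow_neg, Padic.norm_int_le_pow_iff_dvd] at hs
  have h0 : (m * p ^ t - n * p ^ s : ℤ) = 0 := by
    refine Int.eq_zero_of_abs_lt_dvd hs ?_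
    have h1 : m * p ^ t < p ^ (s + t) := by
      rw [pow_add]; exact Nat.mul_lt_mul_of_pos_right hm (pow_pos (Fact.out : p.Prime).pos _)
    have h2 : n * p ^ s < p ^ (s + t) := by
      rw [add_comm, pow_add]
      exact Nat.mul_lt_mul_of_pos_right hn (pow_pos (Fact.out : p.Prime).pos _)
    zify at h1 h2
    have h3 : (0 : ℤ) ≤ m * p ^ t := by positivity
    have h4 : (0 : ℤ) ≤ n * p ^ s := by positivity
    rw [abs_lt]
    constructor <;> lia
  rw [← sub_eq_zero, e, h0]
  simp

theorem exists_mem_H0_sub_mem (x : ℚ_[p]) : ∃ h ∈ H0 p, x - h ∈ ball p 0 := by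
  obtain ⟨k, hk⟩ := exists_mem_ball x
  have hy : ‖x * (p : ℚ_[p]) ^ k‖ ≤ 1 := by
    rw [norm_mul, norm_pow, Padic.norm_p, inv_pow, mul_inv_le_iff₀ (by
      have := one_lt_p p; positivity), one_mul]
    simpa [mem_ball_iff] using hk
  let y : ℤ_[p] := ⟨x * (p : ℚ_[p]) ^ k, hy⟩
  have h1 := (PadicInt.norm_le_pow_iff_mem_span_pow (y - (y.appr k : ℤ_[p])) k).2
    (PadicInt.appr_spec k y)
  refine ⟨(y.appr k : ℚ_[p]) * (p : ℚ_[p]) ^ (-(k : ℤ)),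
    mem_H0_iff.2 ⟨k, y.appr k, PadicInt.appr_lt y k, rfl⟩, ?_⟩
  have h2 : x - (y.appr k : ℚ_[p]) * (p : ℚ_[p]) ^ (-(k : ℤ)) =
      ((y - (y.appr k : ℤ_[p]) : ℤ_[p]) : ℚ_[p]) * (p : ℚ_[p]) ^ (-(k : ℤ)) := by
    have : (y : ℚ_[p]) = x * (p : ℚ_[p]) ^ k := rfl
    have hp := p_ne_zero p
    push_cast
    rw [this, zpow_neg, zpow_natCast]
    field_simp
  rw [h2, mem_ball_iff, norm_mul, Padic.norm_p_zpow, neg_neg, neg_zero, zpow_zero,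
    ← le_div_iff₀ (zpow_p_pos p _), one_div, ← zpow_neg]
  exact h1

/-- With `dil_sub_notMem_ball`, this says that `𝒜^{-n} H_0` represents each coset of `G_n` exactly
once. -/
theorem exists_mem_H0_dil (n : ℤ) (x : ℚ_[p]) : ∃ h : H0 p, x ∈ ballAt n (dil p (-n) h) := by
  obtain ⟨h, hh, hx⟩ := exists_mem_H0_sub_mem (dil p n x)
  refine ⟨⟨h, hh⟩, ?_⟩
  rw [mem_ballAt, ← dil_zero_left (x - _), ← neg_add_cancel n, ← dil_dil, dil_mem_ball, dil_sub,
    dil_dil]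
  simpa using hx

theorem dil_sub_notMem_ball {n : ℤ} {h h' : H0 p} (hne : h ≠ h') :
    dil p (-n) h - dil p (-n) h' ∉ ball p n := fun hm => hne <| by
  rw [← dil_sub, dil_mem_ball, add_neg_cancel] at hm
  exact Subtype.ext (eq_of_mem_H0 h.2 h'.2 hm)

end Representatives

/-! ### Orthonormal bases of wave packets. -/

section Packets

/-- The square root `p^{n/2}` as a complex number. -/
noncomputable def sqrtPow (p : ℕ) (n : ℤ) : ℂ := (((p : ℝ) ^ ((n : ℝ) / 2) : ℝ) : ℂ)

@[simp] theorem sqrtPow_zero (p : ℕ) : sqrtPow p 0 = 1 := by simp [sqrtPow]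

@[simp] theorem conj_sqrtPow (p : ℕ) (n : ℤ) : conj (sqrtPow p n) = sqrtPow p n :=
  Complex.conj_ofReal _

variable {p : ℕ} [Fact p.Prime]

theorem sqrtPow_add (m n : ℤ) : sqrtPow p (m + n) = sqrtPow p m * sqrtPow p n := by
  have := one_lt_p p
  rw [sqrtPow, sqrtPow, sqrtPow, ← Complex.ofReal_mul, ← Real.rpow_add (by positivity)]
  push_cast
  ring_nf

theorem sqrtPow_mul_self (n : ℤ) : sqrtPow p n * sqrtPow p n = (p : ℂ) ^ n := by
  have := one_lt_p p
  rw [sqrtPow, ← Complex.ofReal_mul, ← Real.rpow_add (by positivity), add_halves, Real.rpow_intCast]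
  push_cast
  rfl

theorem sqrtPow_neg_mul (n : ℤ) : sqrtPow p (-n) * sqrtPow p n = 1 := by
  rw [← sqrtPow_add]; simp

theorem sqrtPow_ne_zero (n : ℤ) : sqrtPow p n ≠ 0 := right_ne_zero_of_mul_eq_one (sqrtPow_neg_mul n)

theorem ev_eq_of_mem_annih {n : ℤ} {χ : CharGroup p} (hχ : χ ∈ annih p n) {x h : ℚ_[p]}
    (hx : x ∈ ballAt n h) : ev χ x = ev χ h := by
  rw [← sub_add_cancel x h, ev_add, hχ _ hx, one_mul]

theorem ev_eq_of_mem_coset {n : ℤ} {χ η : CharGroup p} (hχ : χ ∈ coset (-n) η) {x : ℚ_[p]}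
    (hx : x ∈ ball p n) : ev χ x = ev η x := by
  rw [mem_coset, neg_neg] at hχ
  rw [← inv_mul_cancel_right χ η, ev_mul, hχ _ hx, one_mul]

/-- The wave packet `p^{n/2} (a, x - h) 1_{h + G_n}(x)`. -/
noncomputable def packet (n : ℤ) (h : ℚ_[p]) (a : CharGroup p) : ℚ_[p] → ℂ :=
  (ballAt n h).indicator fun x => sqrtPow p n * ev a (x - h)

/-- The Fourier transform `p^{-n/2} conj (χ, h) 1_{a G_n^⊥}(χ)` of a wave packet. -/
noncomputable def dualPacket (n : ℤ) (h : ℚ_[p]) (a : CharGroup p) : CharGroup p → ℂ :=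
  (coset (-n) a).indicator fun χ => sqrtPow p (-n) * conj (ev χ h)

theorem memLp_packet (n : ℤ) (h : ℚ_[p]) (a : CharGroup p) : MemLp (packet n h a) 2 (mu p) := by
  rw [packet, memLp_indicator_iff_restrict (measurableSet_ballAt n h)]
  have : IsFiniteMeasure ((mu p).restrict (ballAt n h)) :=
    isFiniteMeasure_restrict.2 (isCompact_ballAt n h).measure_lt_top.ne
  refine MemLp.of_bound ((continuous_const.mul ((continuous_ev a).comp
    (continuous_id.sub continuous_const))).aestronglyMeasurable) ‖sqrtPow p n‖
    (ae_of_all _ fun x => by simp)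

theorem memLp_dualPacket (n : ℤ) (h : ℚ_[p]) (a : CharGroup p) :
    MemLp (dualPacket n h a) 2 (nu p) := by
  rw [dualPacket, memLp_indicator_iff_restrict (measurableSet_coset _ _)]
  have : IsFiniteMeasure ((nu p).restrict (coset (-n) a)) :=
    isFiniteMeasure_restrict.2 (nu_coset_ne_top _ _)
  refine MemLp.of_bound ((continuous_const.mul (Complex.continuous_conj.comp
    (continuous_ev_left h))).aestronglyMeasurable) ‖sqrtPow p (-n)‖
    (ae_of_all _ fun x => by simp)

theorem inner_toLp_left {Y : Type*} [MeasurableSpace Y] {μ : Measure Y} {g : Y → ℂ}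
    (hg : MemLp g 2 μ) (f : Lp ℂ 2 μ) : inner ℂ (hg.toLp g) f = ∫ y, f y * conj (g y) ∂μ := by
  rw [L2.inner_def]
  refine integral_congr_ae ?_
  filter_upwards [hg.coeFn_toLp] with y hy
  rw [hy, RCLike.inner_apply]

theorem inner_packet (n : ℤ) (h : ℚ_[p]) (a : CharGroup p) (f : Lp ℂ 2 (mu p)) :
    inner ℂ ((memLp_packet n h a).toLp) f =
      sqrtPow p n * ev a h * ∫ x in ballAt n h, f x * ev a⁻¹ x ∂(mu p) := by
  rw [inner_toLp_left, ← integral_indicator (measurableSet_ballAt n h), ← integral_const_mul]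
  congr 1 with x
  by_cases hx : x ∈ ballAt n h
  · rw [packet, Set.indicator_of_mem hx, Set.indicator_of_mem hx, map_mul, conj_sqrtPow, ev_sub,
      map_mul, Complex.conj_conj, ev_inv]
    ring
  · simp [packet, hx]

theorem inner_dualPacket (n : ℤ) (h : ℚ_[p]) (a : CharGroup p) (F : Lp ℂ 2 (nu p)) :
    inner ℂ ((memLp_dualPacket n h a).toLp) F =
      sqrtPow p (-n) * ∫ χ in coset (-n) a, F χ * ev χ h ∂(nu p) := by
  rw [inner_toLp_left, ← integral_indicator (measurableSet_coset _ _), ← integral_const_mul]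
  congr 1 with x
  by_cases hx : x ∈ coset (-n) a
  · rw [dualPacket, Set.indicator_of_mem hx, Set.indicator_of_mem hx, map_mul, conj_sqrtPow,
      Complex.conj_conj]
    ring
  · simp [dualPacket, hx]

theorem inner_packet_packet (n : ℤ) (h h' : ℚ_[p]) (a a' : CharGroup p) :
    inner ℂ ((memLp_packet n h a).toLp) ((memLp_packet n h' a').toLp) =
      sqrtPow p n * ev a h * ∫ x in ballAt n h, packet n h' a' x * ev a⁻¹ x ∂(mu p) := by
  rw [inner_packet]
  congr 1
  refine integral_congr_ae (ae_restrict_of_ae ?_)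
  filter_upwards [(memLp_packet n h' a').coeFn_toLp] with x hx
  rw [hx]

theorem inner_packet_of_notMem {n : ℤ} {h h' : ℚ_[p]} (hh : h - h' ∉ ball p n)
    (a a' : CharGroup p) :
    inner ℂ ((memLp_packet n h a).toLp) ((memLp_packet n h' a').toLp) = 0 := by
  rw [inner_packet_packet, setIntegral_congr_fun (g := fun _ => (0 : ℂ)) (measurableSet_ballAt n h)]
  · simp
  · intro x hx
    simp [packet, Set.disjoint_left.1 (disjoint_ballAt hh) hx]

theorem inner_packet_self (n : ℤ) (h : ℚ_[p]) (a a' : CharGroup p) :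
    inner ℂ ((memLp_packet n h a).toLp) ((memLp_packet n h a').toLp) =
      (annih p n).indicator 1 (a' * a⁻¹) := by
  have e : ∫ x in ballAt n h, packet n h a' x * ev a⁻¹ x ∂(mu p) =
      sqrtPow p n * conj (ev a' h) * ∫ x in ballAt n h, ev (a' * a⁻¹) x ∂(mu p) := by
    rw [← integral_const_mul]
    refine setIntegral_congr_fun (measurableSet_ballAt n h) fun x hx => ?_
    simp only [packet]
    rw [Set.indicator_of_mem hx, ev_sub, ev_mul]
    ring
  rw [inner_packet_packet, e, integral_ballAt_ev]
  by_cases ha : a' * a⁻¹ ∈ annih p n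
  · rw [Set.indicator_of_mem ha, Set.indicator_of_mem ha, Pi.one_apply, ev_mul, ev_inv]
    have h1 := sqrtPow_mul_self (p := p) n
    have h2 := ev_mul_conj a h
    have h3 := ev_mul_conj a' h
    have h4 : (p : ℂ) ^ n * (p : ℂ) ^ (-n) = 1 := by
      rw [← zpow_add₀ (p_complex_ne_zero p)]; simp
    calc _ = (sqrtPow p n * sqrtPow p n) * (p : ℂ) ^ (-n) * (ev a h * conj (ev a h)) *
          (ev a' h * conj (ev a' h)) := by ring
      _ = 1 := by rw [h1, h2, h3, h4]; norm_num
  · simp [ha]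

theorem inner_dualPacket_dualPacket (n : ℤ) (h h' : ℚ_[p]) (a a' : CharGroup p) :
    inner ℂ ((memLp_dualPacket n h a).toLp) ((memLp_dualPacket n h' a').toLp) =
      sqrtPow p (-n) * ∫ χ in coset (-n) a, dualPacket n h' a' χ * ev χ h ∂(nu p) := by
  rw [inner_dualPacket]
  congr 1
  refine integral_congr_ae (ae_restrict_of_ae ?_)
  filter_upwards [(memLp_dualPacket n h' a').coeFn_toLp] with x hx
  rw [hx]

theorem disjoint_coset {s : ℤ} {a a' : CharGroup p} (h : a' * a⁻¹ ∉ annih p (-s)) :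
    Disjoint (coset s a) (coset s a') := by
  rw [Set.disjoint_left]
  intro χ hχ hχ'
  exact h (by simpa using mul_mem_annih (inv_mem_annih hχ') hχ)

theorem inner_dualPacket_of_notMem {n : ℤ} {a a' : CharGroup p} (ha : a' * a⁻¹ ∉ annih p n)
    (h h' : ℚ_[p]) :
    inner ℂ ((memLp_dualPacket n h a).toLp) ((memLp_dualPacket n h' a').toLp) = 0 := by
  rw [inner_dualPacket_dualPacket,
    setIntegral_congr_fun (g := fun _ => (0 : ℂ)) (measurableSet_coset _ _)]
  · simp
  · intro x hx
    simp [dualPacket, Set.disjoint_left.1 (disjoint_coset (by rwa [neg_neg])) hx]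

theorem inner_dualPacket_self (n : ℤ) (h h' : ℚ_[p]) (a : CharGroup p) :
    inner ℂ ((memLp_dualPacket n h a).toLp) ((memLp_dualPacket n h' a).toLp) =
      (ball p n).indicator (ev a) (h - h') := by
  have e : ∫ χ in coset (-n) a, dualPacket n h' a χ * ev χ h ∂(nu p) =
      sqrtPow p (-n) * ∫ χ in coset (-n) a, ev χ (h - h') ∂(nu p) := by
    rw [← integral_const_mul]
    refine setIntegral_congr_fun (measurableSet_coset _ _) fun χ hχ => ?_
    simp only [dualPacket]
    rw [Set.indicator_of_mem hχ, ev_sub]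
    ring
  rw [inner_dualPacket_dualPacket, e, integral_coset_ev]
  by_cases hh : h - h' ∈ ball p n
  · rw [Set.indicator_of_mem hh, Set.indicator_of_mem hh, ← mul_assoc, ← mul_assoc,
      sqrtPow_mul_self, ← zpow_add₀ (p_complex_ne_zero p)]
    simp
  · simp [hh]

/-- The index set of the wave packets at scale `n`. -/
abbrev PacketIndex (p : ℕ) [Fact p.Prime] (n : ℤ) : Type := H0 p × (CharGroup p ⧸ annihSub p n)

/-- The wave packets in `L₂(ℚ_p)` at scale `n`. -/
noncomputable def packetL2 (n : ℤ) (i : PacketIndex p n) : Lp ℂ 2 (mu p) :=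
  (memLp_packet n (dil p (-n) i.1) i.2.out).toLp

/-- The Fourier transforms in `L₂(X)` of the wave packets at scale `n`. -/
noncomputable def dualPacketL2 (n : ℤ) (i : PacketIndex p n) : Lp ℂ 2 (nu p) :=
  (memLp_dualPacket n (dil p (-n) i.1) i.2.out).toLp

theorem out_mul_out_inv_notMem {n : ℤ} {c c' : CharGroup p ⧸ annihSub p n} (h : c ≠ c') :
    c'.out * c.out⁻¹ ∉ annih p n := fun hm => h <| by
  rw [← c.out_eq', ← c'.out_eq']
  refine QuotientGroup.eq.2 ?_
  rw [mul_comm]; exact hm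

theorem out_mk_mul_inv_mem (n : ℤ) (η : CharGroup p) :
    (QuotientGroup.mk η : CharGroup p ⧸ annihSub p n).out * η⁻¹ ∈ annih p n := by
  have h := QuotientGroup.eq.1
    (QuotientGroup.out_eq' (QuotientGroup.mk η : CharGroup p ⧸ annihSub p n)).symm
  rw [mul_comm] at h
  exact h

theorem orthonormal_of_inner {ι E : Type*} [NormedAddCommGroup E] [InnerProductSpace ℂ E]
    {v : ι → E} (h1 : ∀ i, inner ℂ (v i) (v i) = 1) (h0 : ∀ i j, i ≠ j → inner ℂ (v i) (v j) = 0) :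
    Orthonormal ℂ v := by
  classical
  rw [orthonormal_iff_ite]
  intro i j
  by_cases h : i = j
  · subst h; rw [h1, if_pos rfl]
  · simp [h, h0]

/-- Different translates have disjoint supports; on a common support, orthogonality is that of
characters differing by an element outside `G_n^⊥`. For the dual packets the two roles are
exchanged. -/
theorem orthonormal_packetL2 (n : ℤ) : Orthonormal ℂ (packetL2 (p := p) n) := by
  refine orthonormal_of_inner (fun i => ?_) fun i j hij => ?_
  · rw [packetL2, inner_packet_self, Set.indicator_of_mem]
    · rfl
    · simp [one_mem_annih]
  · by_cases h : i.1 = j.1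
    · obtain ⟨h', c⟩ := i
      obtain ⟨h'', c'⟩ := j
      obtain rfl : h' = h'' := h
      have h2 : c ≠ c' := fun h => hij (Prod.ext rfl h)
      rw [packetL2, packetL2, inner_packet_self,
        Set.indicator_of_notMem (out_mul_out_inv_notMem h2)]
    · exact inner_packet_of_notMem (dil_sub_notMem_ball h) _ _

theorem orthonormal_dualPacketL2 (n : ℤ) : Orthonormal ℂ (dualPacketL2 (p := p) n) := by
  refine orthonormal_of_inner (fun i => ?_) fun i j hij => ?_
  · rw [dualPacketL2, inner_dualPacket_self]
    simp [zero_mem_ball]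
  · by_cases h : i.2 = j.2
    · obtain ⟨h', c⟩ := i
      obtain ⟨h'', c'⟩ := j
      obtain rfl : c = c' := h
      have h2 : h' ≠ h'' := fun h => hij (Prod.ext h rfl)
      rw [dualPacketL2, dualPacketL2, inner_dualPacket_self,
        Set.indicator_of_notMem (dil_sub_notMem_ball h2)]
    · exact inner_dualPacket_of_notMem (out_mul_out_inv_notMem h) _ _

theorem locallyIntegrable_Lp {Y : Type*} [TopologicalSpace Y] [MeasurableSpace Y]
    {μ : Measure Y} [IsLocallyFiniteMeasure μ] (f : Lp ℂ 2 μ) : LocallyIntegrable f μ :=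
  (Lp.memLp f).locallyIntegrable one_le_two

/-- A locally integrable function with vanishing wave packet coefficients at scale `n` vanishes. -/
theorem ae_eq_zero_of_forall_packet {f : ℚ_[p] → ℂ} (hf : LocallyIntegrable f (mu p)) (n : ℤ)
    (h0 : ∀ i : PacketIndex p n,
      ∫ x in ballAt n (dil p (-n) i.1), f x * ev (i.2.out)⁻¹ x ∂(mu p) = 0) : f =ᵐ[mu p] 0 := by
  refine ae_eq_zero_of_forall_ballAt_ev hf n fun h χ => ?_
  obtain ⟨h0', hh⟩ := exists_mem_H0_dil n h
  rw [ballAt_eq_of_mem hh]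
  -- If `a` represents the class of `χ⁻¹`, then `a χ ∈ G_n^⊥` is constant on the coset of `G_n`.
  -- Replacing `χ` by `a⁻¹` thus only costs a scalar factor.
  have hz : (QuotientGroup.mk χ⁻¹ : CharGroup p ⧸ annihSub p n).out * χ ∈ annih p n := by
    simpa using out_mk_mul_inv_mem n χ⁻¹
  have h1 := h0 (h0', QuotientGroup.mk χ⁻¹)
  set a := (QuotientGroup.mk χ⁻¹ : CharGroup p ⧸ annihSub p n).out with ha
  have e : ∫ x in ballAt n (dil p (-n) h0'), f x * ev χ x ∂(mu p) =
      ev (a * χ) (dil p (-n) h0') *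
        ∫ x in ballAt n (dil p (-n) h0'), f x * ev a⁻¹ x ∂(mu p) := by
    rw [← integral_const_mul]
    refine setIntegral_congr_fun (measurableSet_ballAt _ _) fun x hx => ?_
    rw [← ev_eq_of_mem_annih hz hx, mul_left_comm, ← ev_mul]
    congr 2
    rw [mul_comm a, mul_inv_cancel_right]
  rw [e]
  simp only [ha] at h1 ⊢
  rw [h1, mul_zero]

/-- A locally integrable function with vanishing dual packet coefficients at scale `n` vanishes. -/
theorem ae_eq_zero_of_forall_dualPacket {F : CharGroup p → ℂ} (hF : LocallyIntegrable F (nu p))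
    (n : ℤ) (h0 : ∀ i : PacketIndex p n,
      ∫ χ in coset (-n) i.2.out, F χ * ev χ (dil p (-n) i.1) ∂(nu p) = 0) : F =ᵐ[nu p] 0 := by
  refine ae_eq_zero_of_forall_coset_ev hF n fun η x => ?_
  obtain ⟨h, hh⟩ := exists_mem_H0_dil n x
  have h1 := h0 (h, QuotientGroup.mk η)
  have hc : (QuotientGroup.mk η : CharGroup p ⧸ annihSub p n).out ∈ coset (-n) η := by
    rw [mem_coset, neg_neg]; exact out_mk_mul_inv_mem n η
  rw [coset_eq_of_mem hc] at h1
  have e : ∫ χ in coset (-n) η, F χ * ev χ x ∂(nu p) = ev η (x - dil p (-n) h) *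
      ∫ χ in coset (-n) η, F χ * ev χ (dil p (-n) h) ∂(nu p) := by
    rw [← integral_const_mul]
    refine setIntegral_congr_fun (measurableSet_coset _ _) fun χ hχ => ?_
    rw [← ev_eq_of_mem_coset hχ hh, mul_left_comm, ← ev_add, sub_add_cancel]
  rw [e, h1, mul_zero]

/-- The Hilbert basis of wave packets at scale `n`. -/
noncomputable def packetBasis (p : ℕ) [Fact p.Prime] (n : ℤ) :
    HilbertBasis (PacketIndex p n) ℂ (Lp ℂ 2 (mu p)) :=
  HilbertBasis.mkOfOrthogonalEqBot (orthonormal_packetL2 n) <| by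
    rw [Submodule.eq_bot_iff]
    intro f hf
    rw [Lp.eq_zero_iff_ae_eq_zero]
    refine ae_eq_zero_of_forall_packet (locallyIntegrable_Lp f) n fun i => ?_
    have h := (Submodule.mem_orthogonal _ _).1 hf _ (Submodule.subset_span ⟨i, rfl⟩)
    rw [packetL2, inner_packet] at h
    exact (mul_eq_zero.1 h).resolve_left (mul_ne_zero (sqrtPow_ne_zero n) (ev_ne_zero _ _))

/-- The Hilbert basis of dual wave packets at scale `n`. -/
noncomputable def dualPacketBasis (p : ℕ) [Fact p.Prime] (n : ℤ) :
    HilbertBasis (PacketIndex p n) ℂ (Lp ℂ 2 (nu p)) :=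
  HilbertBasis.mkOfOrthogonalEqBot (orthonormal_dualPacketL2 n) <| by
    rw [Submodule.eq_bot_iff]
    intro F hF
    rw [Lp.eq_zero_iff_ae_eq_zero]
    refine ae_eq_zero_of_forall_dualPacket (locallyIntegrable_Lp F) n fun i => ?_
    have h := (Submodule.mem_orthogonal _ _).1 hF _ (Submodule.subset_span ⟨i, rfl⟩)
    rw [dualPacketL2, inner_dualPacket] at h
    exact (mul_eq_zero.1 h).resolve_left (sqrtPow_ne_zero _)

@[simp] theorem packetBasis_apply (n : ℤ) (i : PacketIndex p n) :
    packetBasis p n i = packetL2 n i := by simp [packetBasis]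

@[simp] theorem dualPacketBasis_apply (n : ℤ) (i : PacketIndex p n) :
    dualPacketBasis p n i = dualPacketL2 n i := by simp [dualPacketBasis]

end Packets

end PadicFrame

namespace PadicFrame

/-! ### `L₂` norms as integrals. -/

section L2Norm

variable {Y : Type*} [MeasurableSpace Y] {μ : Measure Y}

theorem eLpNorm_two_eq_lintegral (f : Y → ℂ) :
    eLpNorm f 2 μ = (∫⁻ y, ‖f y‖ₑ ^ 2 ∂μ) ^ (1 / 2 : ℝ) := by
  rw [eLpNorm_eq_lintegral_rpow_enorm_toReal (by norm_num) (by norm_num)]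
  simp

theorem enorm_sq_eq_lintegral (f : Lp ℂ 2 μ) : ‖f‖ₑ ^ 2 = ∫⁻ y, ‖f y‖ₑ ^ 2 ∂μ := by
  rw [Lp.enorm_def, eLpNorm_two_eq_lintegral, ← ENNReal.rpow_natCast, ← ENNReal.rpow_mul]
  simp

theorem tendsto_eLpNorm_sub_indicator {f : Y → ℂ} (hf : MemLp f 2 μ) {s : ℕ → Set Y}
    (hs : ∀ n, MeasurableSet (s n)) (h : ∀ y, ∀ᶠ n in atTop, y ∈ s n) :
    Tendsto (fun n => eLpNorm (f - (s n).indicator f) 2 μ) atTop (𝓝 0) := by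
  simp only [eLpNorm_two_eq_lintegral]
  have hfin : ∫⁻ y, ‖f y‖ₑ ^ 2 ∂μ ≠ ∞ := by
    have := hf.2
    rw [eLpNorm_two_eq_lintegral, ENNReal.rpow_lt_top_iff_of_pos (by norm_num)] at this
    exact this.ne
  have key : Tendsto (fun n => ∫⁻ y, ‖(f - (s n).indicator f) y‖ₑ ^ 2 ∂μ) atTop
      (𝓝 (∫⁻ _, 0 ∂μ)) := by
    refine tendsto_lintegral_of_dominated_convergence' (fun y => ‖f y‖ₑ ^ 2) (fun n => ?_)
      (fun n => ae_of_all _ fun y => ?_) hfin (ae_of_all _ fun y => ?_)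
    · exact (hf.1.sub (hf.1.indicator (hs n))).enorm.pow_const 2
    · by_cases hy : y ∈ s n <;> simp [hy]
    · refine tendsto_const_nhds.congr' ?_
      filter_upwards [h y] with n hn
      simp [hn]
  have := (ENNReal.continuous_rpow_const (y := 1 / 2)).tendsto _ |>.comp key
  simpa [Function.comp_def] using this

end L2Norm

/-! ### The Plancherel transform and its agreement with `fhat`. -/

section Plancherel

variable {p : ℕ} [Fact p.Prime]

/-- The Fourier transform as a unitary operator `L₂(ℚ_p) → L₂(X)`. -/
noncomputable def plancherel (p : ℕ) [Fact p.Prime] : Lp ℂ 2 (mu p) ≃ₗᵢ[ℂ] Lp ℂ 2 (nu p) :=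
  (packetBasis p 0).repr.trans (dualPacketBasis p 0).repr.symm

theorem inner_dualPacketL2_plancherel (i : PacketIndex p 0) (f : Lp ℂ 2 (mu p)) :
    inner ℂ (dualPacketL2 0 i) (plancherel p f) = inner ℂ (packetL2 0 i) f := by
  rw [← dualPacketBasis_apply, ← packetBasis_apply, ← HilbertBasis.repr_apply_apply,
    ← HilbertBasis.repr_apply_apply]
  simp [plancherel]

theorem integral_conj_ev_swap {α : Measure (CharGroup p)} {β : Measure ℚ_[p]} [SFinite α]
    [SFinite β] {f : CharGroup p → ℂ} {g : ℚ_[p] → ℂ} (hf : Integrable f α) (hg : Integrable g β) :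
    ∫ χ, ∫ x, f χ * g x * conj (ev χ x) ∂β ∂α = ∫ x, ∫ χ, f χ * g x * conj (ev χ x) ∂α ∂β := by
  refine integral_integral_swap ?_
  refine (hf.mul_prod hg).mul_bdd (c := 1)
    (Complex.continuous_conj.comp continuous_ev_uncurry).aestronglyMeasurable
    (ae_of_all _ fun z => by simp)

theorem integrable_of_memLp_of_support {g : ℚ_[p] → ℂ} (hg : MemLp g 2 (mu p)) {k : ℤ}
    (hk : ∀ x, x ∉ ball p k → g x = 0) : Integrable g (mu p) := by
  rw [← integrableOn_iff_integrable_of_support_subset (s := ball p k)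
    fun x hx => by_contra fun h => hx (hk x h)]
  exact (hg.locallyIntegrable one_le_two).integrableOn_isCompact (isCompact_ball k)

/-- Moving `χ` within its coset of `G_k^⊥` does not change its values on `G_k`, so the Fourier
integral is locally constant. -/
theorem continuous_fourierInt {g : ℚ_[p] → ℂ} {k : ℤ} (hk : ∀ x, x ∉ ball p k → g x = 0) :
    Continuous (fourierInt g) := by
  refine (IsLocallyConstant.iff_eventually_eq _).2 (fun χ => ?_) |>.continuous
  filter_upwards [(isOpen_coset (-k) χ).mem_nhds (self_mem_coset _ _)] with η hη
  refine integral_congr_ae (ae_of_all _ fun x => ?_)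
  by_cases hx : x ∈ ball p k
  · simp only [ev_eq_of_mem_coset hη hx]
  · simp [hk x hx]

/-- For compactly supported functions the Fourier transform is given by the Fourier integral. -/
theorem fourierInt_ae_eq_plancherel {g : ℚ_[p] → ℂ} (hg : MemLp g 2 (mu p)) {k : ℤ}
    (hk : ∀ x, x ∉ ball p k → g x = 0) : fourierInt g =ᵐ[nu p] plancherel p hg.toLp := by
  have hgi := integrable_of_memLp_of_support hg hk
  have hl1 := (continuous_fourierInt hk).locallyIntegrable (μ := nu p)
  have hl2 := locallyIntegrable_Lp (plancherel p hg.toLp)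
  suffices H : fourierInt g - (plancherel p hg.toLp : CharGroup p → ℂ) =ᵐ[nu p] 0 by
    filter_upwards [H] with χ hχ
    exact sub_eq_zero.1 hχ
  -- Both functions are tested against the dual packets at scale `0`. For the Plancherel transform
  -- the coefficient is that of `g` against a packet, by construction; for the Fourier integral,
  -- Fubini gives the same integral over `h + G_0`.
  refine ae_eq_zero_of_forall_dualPacket (hl1.sub hl2) 0 fun i => ?_
  set a := i.2.out with ha
  set h := dil p (-0) (i.1 : ℚ_[p]) with hh
  have hbd {F : CharGroup p → ℂ} (hF : LocallyIntegrable F (nu p)) :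
      Integrable (fun χ => F χ * ev χ h) ((nu p).restrict (coset (-0) a)) :=
    (hF.integrableOn_isCompact (isCompact_coset _ _)).mul_bdd (c := 1)
      (continuous_ev_left h).aestronglyMeasurable (ae_of_all _ fun χ => by simp)
  simp only [Pi.sub_apply, sub_mul]
  rw [integral_sub (hbd hl1) (hbd hl2), sub_eq_zero]
  have e2 : ∫ χ in coset (-0) a, (plancherel p hg.toLp : CharGroup p → ℂ) χ * ev χ h ∂(nu p) =
      ev a h * ∫ x in ballAt 0 h, g x * ev a⁻¹ x ∂(mu p) := by
    have h1 := inner_dualPacketL2_plancherel i hg.toLp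
    rw [packetL2, dualPacketL2, inner_dualPacket, inner_packet, neg_zero, sqrtPow_zero, one_mul,
      one_mul] at h1
    refine Eq.trans ?_ (h1.trans ?_)
    · rw [ha, hh, neg_zero]
    · simp only [ha, hh, neg_zero]
      congr 1
      refine integral_congr_ae (ae_restrict_of_ae ?_)
      filter_upwards [hg.coeFn_toLp] with x hx
      rw [hx]
  have h1 := integral_conj_ev_swap (p := p) (α := (nu p).restrict (coset (-0) a)) (β := mu p)
    (f := fun χ => ev χ h) (g := g) (by
      have := hbd (F := fun _ => 1) (locallyIntegrable_const 1)
      simpa using this) hgi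
  have h2 : ∀ χ, ∫ x, ev χ h * g x * conj (ev χ x) ∂(mu p) = fourierInt g χ * ev χ h := fun χ => by
    simp only [mul_assoc]
    rw [integral_const_mul, mul_comm]
    rfl
  have h3 : ∀ x, ∫ χ in coset (-0) a, ev χ h * g x * conj (ev χ x) ∂(nu p) =
      (ballAt 0 h).indicator (fun x => ev a h * (g x * ev a⁻¹ x)) x := fun x => by
    have : ∀ χ : CharGroup p, ev χ h * g x * conj (ev χ x) = g x * ev χ (h - x) := fun χ => by
      rw [ev_sub]; ring
    simp only [this]
    rw [integral_const_mul, integral_coset_ev]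
    have hiff : h - x ∈ ball p 0 ↔ x ∈ ballAt 0 h :=
      ⟨fun H => by simpa [mem_ballAt] using neg_mem_ball H, fun H => by
        simpa [mem_ballAt] using neg_mem_ball H⟩
    by_cases hx : x ∈ ballAt 0 h
    · rw [Set.indicator_of_mem hx, Set.indicator_of_mem (hiff.2 hx), zpow_zero, one_mul, ev_sub,
        ev_inv]
      ring
    · rw [Set.indicator_of_notMem hx, Set.indicator_of_notMem (mt hiff.1 hx), mul_zero]
  simp only [h2, h3] at h1
  rw [h1, e2, integral_indicator (measurableSet_ballAt _ _), integral_const_mul]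

theorem eventually_mem_ball (x : ℚ_[p]) : ∀ᶠ n : ℕ in atTop, x ∈ ball p (-(n : ℤ)) := by
  obtain ⟨k, hk⟩ := exists_mem_ball x
  filter_upwards [eventually_ge_atTop k] with n hn
  exact ball_subset_ball (by lia) hk

theorem setIntegral_ball_eq_fourierInt (f : ℚ_[p] → ℂ) (k : ℤ) (χ : CharGroup p) :
    ∫ x in ball p k, f x * conj (ev χ x) ∂(mu p) = fourierInt ((ball p k).indicator f) χ := by
  rw [fourierInt, ← integral_indicator (measurableSet_ball _)]
  congr 1 with x
  by_cases hx : x ∈ ball p k <;> simp [hx]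

/-- The truncations of `f` to `G_{-n}` converge to `f` in `L₂`, and the isometry carries the
truncation error unchanged to the Fourier side. -/
theorem isFourierTransform_plancherel (f : Lp ℂ 2 (mu p)) :
    IsFourierTransform f (plancherel p f) := by
  refine ⟨Lp.memLp _, ?_⟩
  have h1 := tendsto_eLpNorm_sub_indicator (Lp.memLp f)
    (fun n : ℕ => measurableSet_ball (p := p) (-(n : ℤ))) eventually_mem_ball
  refine h1.congr fun n => ?_
  have hm : MemLp ((ball p (-(n : ℤ))).indicator f) 2 (mu p) :=
    (Lp.memLp f).indicator (measurableSet_ball _)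
  have h2 := fourierInt_ae_eq_plancherel hm (k := -(n : ℤ)) fun x hx =>
    Set.indicator_of_notMem hx _
  simp only [setIntegral_ball_eq_fourierInt]
  calc eLpNorm ((f : ℚ_[p] → ℂ) - (ball p (-(n : ℤ))).indicator f) 2 (mu p) = ‖f - hm.toLp‖ₑ := by
        rw [Lp.enorm_def]
        refine eLpNorm_congr_ae ?_
        filter_upwards [Lp.coeFn_sub f hm.toLp, hm.coeFn_toLp] with x hx hx'
        rw [hx, Pi.sub_apply, Pi.sub_apply, hx']
    _ = ‖plancherel p f - plancherel p hm.toLp‖ₑ := by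
        rw [← map_sub, LinearIsometryEquiv.enorm_map]
    _ = _ := by
        rw [Lp.enorm_def]
        refine eLpNorm_congr_ae ?_
        filter_upwards [Lp.coeFn_sub (plancherel p f) (plancherel p hm.toLp), h2] with χ hχ hχ'
        rw [hχ, Pi.sub_apply, hχ']

theorem IsFourierTransform.ae_eq {f : ℚ_[p] → ℂ} {F G : CharGroup p → ℂ}
    (hF : IsFourierTransform f F) (hG : IsFourierTransform f G)
    (hm : ∀ n : ℕ, AEStronglyMeasurable
      (fun χ => ∫ x in ball p (-(n : ℤ)), f x * conj (ev χ x) ∂(mu p)) (nu p)) :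
    F =ᵐ[nu p] G := by
  have h0 : eLpNorm (F - G) 2 (nu p) ≤ 0 := by
    have hlim := hF.2.add hG.2
    rw [add_zero] at hlim
    refine ge_of_tendsto' hlim fun n => ?_
    set Φ := fun χ => ∫ x in ball p (-(n : ℤ)), f x * conj (ev χ x) ∂(mu p)
    have e : F - G = (fun χ => F χ - Φ χ) - fun χ => G χ - Φ χ := by
      ext χ; simp
    rw [e]
    exact eLpNorm_sub_le (hF.1.1.sub (hm n)) (hG.1.1.sub (hm n)) one_le_two
  have h1 := (eLpNorm_eq_zero_iff (hF.1.1.sub hG.1.1) (by norm_num)).1 (le_antisymm h0 bot_le)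
  filter_upwards [h1] with χ hχ
  exact sub_eq_zero.1 hχ

/-- `fhat` is an arbitrary choice of transform; uniqueness of `L₂`-limits makes the choice harmless.
-/
theorem fhat_ae_eq_plancherel (f : Lp ℂ 2 (mu p)) : fhat f =ᵐ[nu p] plancherel p f := by
  have hex : ∃ F, IsFourierTransform (f : ℚ_[p] → ℂ) F := ⟨_, isFourierTransform_plancherel f⟩
  rw [fhat, dif_pos hex]
  refine hex.choose_spec.ae_eq (isFourierTransform_plancherel f) fun n => ?_
  simp only [setIntegral_ball_eq_fourierInt]
  exact (continuous_fourierInt fun x hx => Set.indicator_of_notMem hx _).aestronglyMeasurable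

end Plancherel

end PadicFrame

namespace PadicFrame

/-! ### Reproducing formula from Bessel's inequality. -/

section Frames

variable {ι E : Type*} [NormedAddCommGroup E] [InnerProductSpace ℂ E]

theorem tsum_enorm_inner_sq (b : HilbertBasis ι ℂ E) (x : E) :
    ∑' i, ‖inner ℂ (b i) x‖ₑ ^ 2 = ‖x‖ₑ ^ 2 := by
  have h1 := (b.hasSum_inner_mul_inner x x).mapL Complex.reCLM
  have h2 : HasSum (fun i => ‖inner ℂ (b i) x‖ ^ 2) (‖x‖ ^ 2) := by
    convert h1 using 1
    · ext i
      rw [← inner_conj_symm x, mul_comm, Complex.mul_conj, Complex.normSq_eq_norm_sq]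
      simp only [Complex.reCLM_apply, Complex.ofReal_re]
    · exact (inner_self_eq_norm_sq (𝕜 := ℂ) x).symm
  have h3 := ENNReal.ofReal_tsum_of_nonneg (fun i => sq_nonneg ‖inner ℂ (b i) x‖) h2.summable
  rw [h2.tsum_eq] at h3
  simp only [ENNReal.ofReal_pow (norm_nonneg _), ofReal_norm] at h3
  exact h3.symm

/-- If a family satisfies Bessel's inequality, then it reproduces every vector for which Bessel's
inequality is an equality. -/
theorem hasSum_inner_smul_of_bessel {e : ι → E}
    (hB : ∀ x, ∑' i, ‖inner ℂ (e i) x‖ₑ ^ 2 ≤ ‖x‖ₑ ^ 2) {x : E}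
    (hx : ∑' i, ‖inner ℂ (e i) x‖ₑ ^ 2 = ‖x‖ₑ ^ 2) :
    HasSum (fun i => inner ℂ (e i) x • e i) x := by
  have hreal (y : E) (s : Finset ι) :
      (∑ i ∈ s, ‖inner ℂ (e i) y‖ₑ ^ 2).toReal = ∑ i ∈ s, ‖inner ℂ (e i) y‖ ^ 2 := by
    rw [ENNReal.toReal_sum (fun i _ => by simp)]
    simp
  have hfin (y : E) (s : Finset ι) : ∑ i ∈ s, ‖inner ℂ (e i) y‖ ^ 2 ≤ ‖y‖ ^ 2 := by
    rw [← hreal]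
    refine (ENNReal.toReal_mono (by simp) ((ENNReal.sum_le_tsum s).trans (hB y))).trans ?_
    simp
  have hlim : Tendsto (fun s => ∑ i ∈ s, ‖inner ℂ (e i) x‖ ^ 2) atTop (𝓝 (‖x‖ ^ 2)) := by
    have h1 : Tendsto (fun s : Finset ι => ∑ i ∈ s, ‖inner ℂ (e i) x‖ₑ ^ 2) atTop
        (𝓝 (‖x‖ₑ ^ 2)) := hx ▸ ENNReal.summable.hasSum
    have h2 := (ENNReal.tendsto_toReal (by simp : ‖x‖ₑ ^ 2 ≠ ∞)).comp h1
    simpa [Function.comp_def, hreal] using h2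
  -- Expanding `‖S‖²` gives `∑ |⟨e_i, x⟩| |⟨e_i, S⟩|`, at most half of `∑ |⟨e_i, x⟩|² + ∑ |⟨e_i,
  -- S⟩|²`. Bessel applied to `S` itself lets the second sum be absorbed.
  have hsynth (s : Finset ι) :
      ‖∑ i ∈ s, inner ℂ (e i) x • e i‖ ^ 2 ≤ ∑ i ∈ s, ‖inner ℂ (e i) x‖ ^ 2 := by
    set S := ∑ i ∈ s, inner ℂ (e i) x • e i with hS
    have h1 : ‖S‖ ^ 2 ≤ ∑ i ∈ s, ‖inner ℂ (e i) x‖ * ‖inner ℂ (e i) S‖ := by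
      have h2 : inner ℂ S S = ∑ i ∈ s, inner ℂ x (e i) * inner ℂ (e i) S := by
        conv_lhs => rw [hS, sum_inner]
        exact Finset.sum_congr rfl fun i _ => by rw [inner_smul_left, inner_conj_symm]
      have h3 : ‖inner ℂ S S‖ = ‖S‖ ^ 2 := by
        rw [inner_self_eq_norm_sq_to_K]; simp
      rw [← h3, h2]
      refine (norm_sum_le _ _).trans (le_of_eq (Finset.sum_congr rfl fun i _ => ?_))
      rw [norm_mul, norm_inner_symm]
    have h4 : ∑ i ∈ s, ‖inner ℂ (e i) x‖ * ‖inner ℂ (e i) S‖ ≤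
        ∑ i ∈ s, (‖inner ℂ (e i) x‖ ^ 2 + ‖inner ℂ (e i) S‖ ^ 2) / 2 :=
      Finset.sum_le_sum fun i _ => by
        nlinarith [sq_nonneg (‖inner ℂ (e i) x‖ - ‖inner ℂ (e i) S‖)]
    rw [← Finset.sum_div, Finset.sum_add_distrib] at h4
    linarith [hfin S s]
  -- In `‖S - x‖²` the cross term is minus twice the partial Bessel sum, so with `hsynth` the defect
  -- in Bessel's inequality controls the distance.
  have hdist (s : Finset ι) : ‖∑ i ∈ s, inner ℂ (e i) x • e i - x‖ ^ 2 ≤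
      ‖x‖ ^ 2 - ∑ i ∈ s, ‖inner ℂ (e i) x‖ ^ 2 := by
    have h1 : RCLike.re (inner ℂ (∑ i ∈ s, inner ℂ (e i) x • e i) x) =
        ∑ i ∈ s, ‖inner ℂ (e i) x‖ ^ 2 := by
      rw [sum_inner, map_sum]
      refine Finset.sum_congr rfl fun i _ => ?_
      rw [inner_smul_left, mul_comm, Complex.mul_conj, Complex.normSq_eq_norm_sq]
      exact Complex.ofReal_re _
    rw [@norm_sub_sq ℂ, h1]
    linarith [hsynth s]
  rw [HasSum, SummationFilter.unconditional_filter, tendsto_iff_norm_sub_tendsto_zero]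
  have h2 : Tendsto (fun s => ‖∑ i ∈ s, inner ℂ (e i) x • e i - x‖ ^ 2) atTop (𝓝 0) := by
    refine squeeze_zero (fun s => sq_nonneg _) hdist ?_
    have h1 := hlim.const_sub (‖x‖ ^ 2)
    rwa [sub_self] at h1
  have h3 := (Real.continuous_sqrt.tendsto 0).comp h2
  simpa [Function.comp_def, Real.sqrt_sq] using h3

end Frames

theorem tsum_prod_prod {α β κ : Type*} (F : α → β → κ → ℝ≥0∞) :
    ∑' i : α × β × κ, F i.1 i.2.1 i.2.2 = ∑' i : α × β, ∑' k, F i.1 i.2 k := by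
  rw [ENNReal.tsum_prod', ENNReal.tsum_prod']
  exact tsum_congr fun a => ENNReal.tsum_prod'

/-! ### Wavelets on the Fourier side, and convergence of the series. -/

section Wavelets

variable {p : ℕ} [Fact p.Prime]

theorem exists_ball_of_hasCompactSupport {g : ℚ_[p] → ℂ} (hg : HasCompactSupport g) :
    ∃ k : ℤ, ∀ x, x ∉ ball p k → g x = 0 := by
  obtain ⟨R, hR⟩ := hg.isBounded.exists_norm_le
  obtain ⟨k, hk⟩ := pow_unbounded_of_one_lt R (one_lt_p p)
  refine ⟨-(k : ℤ), fun x hx => image_eq_zero_of_notMem_tsupport fun h => hx ?_⟩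
  rw [mem_ball_iff, neg_neg, zpow_natCast]
  exact (hR x h).trans hk.le

theorem integral_comp_dil (n : ℤ) (F : ℚ_[p] → ℂ) :
    ∫ x, F (dil p n x) ∂(mu p) = (p : ℂ) ^ (-n) * ∫ x, F x ∂(mu p) := by
  have hme : MeasurableEmbedding (dil p n) :=
    (Homeomorph.mulLeft₀ _ (p_pow_ne_zero (p := p) (-n))).measurableEmbedding
  rw [← hme.integral_map, map_dil_mu, integral_smul_measure, ← measureReal_def, mu_real_ball,
    Complex.real_smul]
  push_cast
  rfl

theorem fourierInt_atom (g : ℚ_[p] → ℂ) (n : ℤ) (h : ℚ_[p]) (χ : CharGroup p) :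
    fourierInt (atom g n h) χ =
      (p : ℂ) ^ (-n) * (conj (ev χ (dil p (-n) h)) * fourierInt g (cdil (-n) χ)) := by
  have h1 : fourierInt (atom g n h) χ =
      ∫ x, (fun y => g (y - h) * conj (ev χ (dil p (-n) y))) (dil p n x) ∂(mu p) := by
    simp [fourierInt, atom, dil_dil]
  rw [h1, integral_comp_dil n fun y => g (y - h) * conj (ev χ (dil p (-n) y)),
    ← integral_add_right_eq_self _ h, fourierInt]
  congr 1
  rw [← integral_const_mul]
  refine integral_congr_ae (ae_of_all _ fun x => ?_)
  beta_reduce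
  rw [add_sub_cancel_right, dil_add, ev_add, map_mul, ev_cdil]
  ring

theorem fourierInt_const_mul (c : ℂ) (g : ℚ_[p] → ℂ) (χ : CharGroup p) :
    fourierInt (fun x => c * g x) χ = c * fourierInt g χ := by
  simp only [fourierInt, mul_assoc]
  exact integral_const_mul _ _

theorem fourierInt_finset_sum {κ : Type*} (s : Finset κ) {g : κ → ℚ_[p] → ℂ}
    (hg : ∀ i ∈ s, Integrable (g i) (mu p)) (χ : CharGroup p) :
    fourierInt (fun x => ∑ i ∈ s, g i x) χ = ∑ i ∈ s, fourierInt (g i) χ := by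
  simp only [fourierInt, Finset.sum_mul]
  refine integral_finsetSum _ fun i hi => ?_
  exact (hg i hi).mul_bdd (c := 1)
    (Complex.continuous_conj.comp (continuous_ev χ)).aestronglyMeasurable
    (ae_of_all _ fun x => by simp)

theorem fourierInt_refineSum {φ : ℚ_[p] → ℂ} (hφ : Continuous φ) (hc : HasCompactSupport φ)
    (β : H0 p →₀ ℂ) (χ : CharGroup p) :
    fourierInt (refineSum φ β) χ = fourierInt φ (cdil (-1) χ) * mask β χ := by
  have e : refineSum φ β =
      fun x => (p : ℂ) * (fun x => ∑ h ∈ β.support, (β h * atom φ 1 h x)) x := rfl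
  rw [e, fourierInt_const_mul, fourierInt_finset_sum, mask, Finsupp.sum, Finset.mul_sum,
    Finset.mul_sum]
  · refine Finset.sum_congr rfl fun h _ => ?_
    rw [fourierInt_const_mul, fourierInt_atom, ev_cdil, zpow_neg_one]
    field_simp [p_complex_ne_zero p]
  · intro h _
    obtain ⟨h1, h2⟩ := good_atom hφ hc 1 (h : ℚ_[p])
    exact (h1.integrable_of_hasCompactSupport h2).const_mul _

namespace WaveletSystem

variable {M N q : ℕ} (W : WaveletSystem p M N q)

/-- The set `E_j 𝒜^n`. -/
def dilE (n : ℤ) (j : Fin q) : Set (CharGroup p) := cdil (-n) ⁻¹' W.E j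

theorem dilE_eq_coset (n : ℤ) (j : Fin q) :
    W.dilE n j = coset (W.s j - n) (cdil n (W.η j)) := cdil_preimage_coset _ _ _

theorem measurableSet_dilE (n : ℤ) (j : Fin q) : MeasurableSet (W.dilE n j) := by
  rw [dilE_eq_coset]; exact measurableSet_coset _ _

theorem dilE_subset_coset (n : ℤ) (j : Fin q) : W.dilE n j ⊆ coset (-n) (cdil n (W.η j)) := by
  rw [dilE_eq_coset]; exact coset_subset_coset (by lia) _

theorem fourierInt_ψ (j : Fin q) : fourierInt (W.ψ j) = (W.E j).indicator 1 := by
  ext χ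
  rw [ψ, fourierInt_refineSum W.φ_step.continuous W.φ_step.hasCompactSupport, W.mask_eq]
  rfl

theorem fourierInt_ψFun (n : ℤ) (j : Fin q) (h : ℚ_[p]) : fourierInt (W.ψFun n j h) =
    (W.dilE n j).indicator fun χ => sqrtPow p (-n) * conj (ev χ (dil p (-n) h)) := by
  ext χ
  have e : W.ψFun n j h = fun x => sqrtPow p n * atom (W.ψ j) n h x := rfl
  have h1 : sqrtPow p n * (p : ℂ) ^ (-n) = sqrtPow p (-n) := by
    rw [← sqrtPow_mul_self, ← mul_assoc, mul_comm (sqrtPow p n), sqrtPow_neg_mul, one_mul]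
  rw [e, fourierInt_const_mul, fourierInt_atom, fourierInt_ψ, ← mul_assoc, h1]
  by_cases hχ : cdil (-n) χ ∈ W.E j
  · rw [Set.indicator_of_mem hχ, Set.indicator_of_mem (show χ ∈ W.dilE n j from hχ)]
    simp
  · rw [Set.indicator_of_notMem hχ, Set.indicator_of_notMem (show χ ∉ W.dilE n j from hχ)]
    simp

theorem plancherel_ψL2 (n : ℤ) (j : Fin q) (h : ℚ_[p]) : plancherel p (W.ψL2 n j h) =ᵐ[nu p]
    (W.dilE n j).indicator fun χ => sqrtPow p (-n) * conj (ev χ (dil p (-n) h)) := by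
  obtain ⟨h1, h2⟩ := good_refine W.φ_step.continuous W.φ_step.hasCompactSupport (W.β j)
  obtain ⟨h3, h4⟩ := good_atom h1 h2 n h
  obtain ⟨k, hk⟩ := exists_ball_of_hasCompactSupport h4
  rw [← fourierInt_ψFun]
  refine (fourierInt_ae_eq_plancherel (W.memLp_ψFun n j h) (k := k) fun x hx => ?_).symm
  exact mul_eq_zero_of_right _ (hk x hx)

theorem inner_ψL2 (n : ℤ) (j : Fin q) (h : ℚ_[p]) (f : Lp ℂ 2 (mu p)) :
    inner ℂ (W.ψL2 n j h) f = sqrtPow p (-n) *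
      ∫ χ in W.dilE n j, plancherel p f χ * ev χ (dil p (-n) h) ∂(nu p) := by
  rw [← (plancherel p).inner_map_map, L2.inner_def, ← integral_const_mul,
    ← integral_indicator (W.measurableSet_dilE n j)]
  refine integral_congr_ae ?_
  filter_upwards [W.plancherel_ψL2 n j h] with χ hχ
  rw [hχ, RCLike.inner_apply]
  by_cases hm : χ ∈ W.dilE n j
  · rw [Set.indicator_of_mem hm, Set.indicator_of_mem hm, map_mul, conj_sqrtPow,
      Complex.conj_conj]
    ring
  · simp [hm]

/-- Parseval in the dual packet basis for `f̂` cut off to `E_j 𝒜^n`. Only the coset of `G_n^⊥`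
containing this set contributes, and there the packet coefficients are exactly the wavelet
coefficients of `f`. -/
theorem tsum_enorm_inner_ψL2 (n : ℤ) (j : Fin q) (f : Lp ℂ 2 (mu p)) :
    ∑' h : H0 p, ‖inner ℂ (W.ψL2 n j h) f‖ₑ ^ 2 =
      ∫⁻ χ in W.dilE n j, ‖plancherel p f χ‖ₑ ^ 2 ∂(nu p) := by
  have hm : MemLp ((W.dilE n j).indicator (plancherel p f)) 2 (nu p) :=
    (Lp.memLp _).indicator (W.measurableSet_dilE n j)
  have hinner (i : PacketIndex p n) : inner ℂ (dualPacketL2 n i) hm.toLp =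
      sqrtPow p (-n) * ∫ χ in coset (-n) i.2.out ∩ W.dilE n j,
        plancherel p f χ * ev χ (dil p (-n) i.1) ∂(nu p) := by
    rw [dualPacketL2, inner_dualPacket, ← setIntegral_indicator (W.measurableSet_dilE n j)]
    congr 1
    refine integral_congr_ae (ae_restrict_of_ae ?_)
    filter_upwards [hm.coeFn_toLp] with χ hχ
    rw [hχ]
    by_cases h : χ ∈ W.dilE n j <;> simp [h]
  set c : CharGroup p ⧸ annihSub p n := QuotientGroup.mk (cdil n (W.η j)) with hc
  have hcoset : coset (-n) c.out = coset (-n) (cdil n (W.η j)) := coset_eq_of_mem (by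
    rw [mem_coset, neg_neg]; exact out_mk_mul_inv_mem n _)
  have hone (h : H0 p) : inner ℂ (dualPacketL2 n (h, c)) hm.toLp = inner ℂ (W.ψL2 n j h) f := by
    rw [hinner, inner_ψL2, hcoset, Set.inter_eq_right.2 (W.dilE_subset_coset n j)]
  have hzero (h : H0 p) (c' : CharGroup p ⧸ annihSub p n) (hne : c' ≠ c) :
      ‖inner ℂ (dualPacketL2 n (h, c')) hm.toLp‖ₑ ^ 2 = 0 := by
    have hd : coset (-n) c'.out ∩ W.dilE n j = ∅ := by
      have := disjoint_coset (s := -n) (a := c'.out) (a' := c.out)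
        (by rw [neg_neg]; exact out_mul_out_inv_notMem hne)
      refine Set.disjoint_iff_inter_eq_empty.1 (this.mono_right ?_)
      rw [hcoset]
      exact W.dilE_subset_coset n j
    rw [hinner, hd]
    simp
  have h1 := tsum_enorm_inner_sq (dualPacketBasis p n) hm.toLp
  simp only [dualPacketBasis_apply] at h1
  rw [ENNReal.tsum_prod', enorm_sq_eq_lintegral] at h1
  calc ∑' h : H0 p, ‖inner ℂ (W.ψL2 n j h) f‖ₑ ^ 2
      = ∑' (h : H0 p) (c' : CharGroup p ⧸ annihSub p n),
          ‖inner ℂ (dualPacketL2 n (h, c')) hm.toLp‖ₑ ^ 2 := by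
        refine tsum_congr fun h => ?_
        rw [tsum_eq_single c (hzero h), hone]
    _ = _ := by
        rw [h1, ← lintegral_indicator (W.measurableSet_dilE n j)]
        refine lintegral_congr_ae ?_
        filter_upwards [hm.coeFn_toLp] with χ hχ
        rw [hχ]
        by_cases h : χ ∈ W.dilE n j <;> simp [h]

theorem mem_image_cdil {s : Set (CharGroup p)} {n : ℤ} {χ : CharGroup p} :
    χ ∈ cdil n '' s ↔ cdil (-n) χ ∈ s := by
  constructor
  · rintro ⟨η, hη, rfl⟩
    simpa [cdil_cdil] using hη
  · intro h
    exact ⟨_, h, by simp [cdil_cdil]⟩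

theorem mem_dilE {n : ℤ} {j : Fin q} {χ : CharGroup p} :
    χ ∈ W.dilE n j ↔ cdil (W.t j - n) χ ∈ cdil (W.t j) '' W.E j := by
  rw [mem_image_cdil, cdil_cdil, show -(W.t j : ℤ) + (W.t j - n) = -n by ring]
  rfl

theorem mem_annih_of_mem_dilE {n : ℤ} {j : Fin q} {χ : CharGroup p} (h : χ ∈ W.dilE n j) :
    χ ∈ annih p (M + 1 + n - W.t j) ∧ χ ∉ annih p (M + n - W.t j) := by
  have h1 : cdil (W.t j - n) χ ∈ annih p (M + 1) \ annih p M :=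
    W.tiling ▸ Set.mem_iUnion.2 ⟨j, W.mem_dilE.1 h⟩
  rw [Set.mem_sdiff, cdil_mem_annih, cdil_mem_annih] at h1
  convert h1 using 3 <;> ring_nf

/-- A common point lies in a single annulus, which determines `n - t(j)`. Dilating back to
`G_{M+1}^⊥ \ G_M^⊥` then contradicts disjointness of the tiles if `j ≠ j'`, and forces `n = n'` if
`j = j'`. -/
theorem disjoint_dilE {n n' : ℤ} {j j' : Fin q} (h : (n, j) ≠ (n', j')) :
    Disjoint (W.dilE n j) (W.dilE n' j') := by
  rw [Set.disjoint_left]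
  intro χ hχ hχ'
  obtain ⟨h1, h2⟩ := W.mem_annih_of_mem_dilE hχ
  obtain ⟨h1', h2'⟩ := W.mem_annih_of_mem_dilE hχ'
  have e : n - W.t j = n' - W.t j' := by
    rcases lt_trichotomy (n - W.t j) (n' - W.t j') with hlt | heq | hlt
    · exact absurd (annih_mono (by lia) h1) h2'
    · exact heq
    · exact absurd (annih_mono (by lia) h1') h2
  by_cases hj : j = j'
  · subst hj
    exact h (by rw [sub_left_injective e])
  · refine Set.disjoint_left.1 (W.disjoint_dil j j' hj) (W.mem_dilE.1 hχ) ?_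
    have := W.mem_dilE.1 hχ'
    rwa [show (W.t j' : ℤ) - n' = W.t j - n by lia] at this

/-- The part of the frequency domain which is covered by the scales `n ≤ K`. -/
def cover (K : ℤ) : Set (CharGroup p) := ⋃ i : {n : ℤ // n ≤ K} × Fin q, W.dilE i.1 i.2

theorem measurableSet_cover (K : ℤ) : MeasurableSet (W.cover K) :=
  MeasurableSet.iUnion fun _ => W.measurableSet_dilE _ _

theorem pairwise_disjoint_dilE (K : ℤ) : Pairwise (Function.onFun Disjoint
    fun i : {n : ℤ // n ≤ K} × Fin q => W.dilE i.1 i.2) := by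
  intro i i' hne
  refine W.disjoint_dilE fun h => hne ?_
  exact Prod.ext (Subtype.ext (Prod.mk.inj h).1) (Prod.mk.inj h).2

theorem lintegral_cover (K : ℤ) (G : CharGroup p → ℝ≥0∞) :
    ∫⁻ χ in W.cover K, G χ ∂(nu p) =
      ∑' i : {n : ℤ // n ≤ K} × Fin q, ∫⁻ χ in W.dilE i.1 i.2, G χ ∂(nu p) := by
  have hm : ∀ i : {n : ℤ // n ≤ K} × Fin q, MeasurableSet (W.dilE i.1 i.2) :=
    fun i => W.measurableSet_dilE i.1 i.2
  rw [cover]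
  exact lintegral_iUnion hm (W.pairwise_disjoint_dilE K) G

theorem tsum_enorm_inner_scales (K : ℤ) (f : Lp ℂ 2 (mu p)) :
    ∑' i : {n : ℤ // n ≤ K} × Fin q × H0 p, ‖inner ℂ (W.ψL2 i.1 i.2.1 i.2.2) f‖ₑ ^ 2 =
      ∫⁻ χ in W.cover K, ‖plancherel p f χ‖ₑ ^ 2 ∂(nu p) := by
  rw [lintegral_cover, tsum_prod_prod fun (n : {n : ℤ // n ≤ K}) j (h : H0 p) =>
    ‖inner ℂ (W.ψL2 n j h) f‖ₑ ^ 2]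
  exact tsum_congr fun i => W.tsum_enorm_inner_ψL2 i.1 i.2 f

/-- The frame series of `f` converges unconditionally to the part of `f` with frequencies in the
sets `E_j 𝒜^n`, `n ≤ K`. -/
theorem exists_hasSum_term (K : ℤ) (f : Lp ℂ 2 (mu p)) : ∃ g : Lp ℂ 2 (mu p),
    HasSum (W.term f K) g ∧
      plancherel p g =ᵐ[nu p] (W.cover K).indicator (plancherel p f) := by
  have hm : MemLp ((W.cover K).indicator (plancherel p f)) 2 (nu p) :=
    (Lp.memLp _).indicator (W.measurableSet_cover K)
  set e : {n : ℤ // n ≤ K} × Fin q × H0 p → Lp ℂ 2 (mu p) :=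
    fun i => W.ψL2 i.1 i.2.1 i.2.2 with he
  set g := (plancherel p).symm hm.toLp with hg
  have hTg : plancherel p g =ᵐ[nu p] (W.cover K).indicator (plancherel p f) := by
    rw [hg, LinearIsometryEquiv.apply_symm_apply]
    exact hm.coeFn_toLp
  have hB (x : Lp ℂ 2 (mu p)) : ∑' i, ‖inner ℂ (e i) x‖ₑ ^ 2 ≤ ‖x‖ₑ ^ 2 := by
    rw [he, W.tsum_enorm_inner_scales K x, ← (plancherel p).enorm_map x, enorm_sq_eq_lintegral]
    exact setLIntegral_le_lintegral _ _
  have hx : ∑' i, ‖inner ℂ (e i) g‖ₑ ^ 2 = ‖g‖ₑ ^ 2 := by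
    rw [he, W.tsum_enorm_inner_scales K g, ← (plancherel p).enorm_map g, enorm_sq_eq_lintegral,
      ← lintegral_indicator (W.measurableSet_cover K)]
    refine lintegral_congr_ae ?_
    filter_upwards [hTg] with χ hχ
    by_cases h : χ ∈ W.cover K <;> simp [h, hχ]
  -- `f - g` has no frequencies in `cover K`, so the energy identity kills all its coefficients: the
  -- series of `f` is that of `g`, for which Bessel is an equality.
  have hfg (i) : inner ℂ (e i) f = inner ℂ (e i) g := by
    have h0 : ∑' i, ‖inner ℂ (e i) (f - g)‖ₑ ^ 2 = 0 := by
      rw [he, W.tsum_enorm_inner_scales K (f - g),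
        setLIntegral_eq_zero_iff' (W.measurableSet_cover K)]
      · rw [map_sub]
        filter_upwards [hTg, Lp.coeFn_sub (plancherel p f) (plancherel p g)] with χ h1 h2 hχ
        rw [h2, Pi.sub_apply, h1, Set.indicator_of_mem hχ]
        simp
      · exact ((Lp.aestronglyMeasurable _).enorm.pow_const 2).restrict
    have h1 := ENNReal.tsum_eq_zero.1 h0 i
    rw [inner_sub_right] at h1
    simpa [sub_eq_zero] using h1
  refine ⟨g, ?_, hTg⟩
  have h := hasSum_inner_smul_of_bessel hB hx
  simp only [← hfg] at h
  exact h

end WaveletSystem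

end Wavelets

end PadicFrame

namespace PadicFrame

/-! ### Levels of characters and the error as a tail of `f̂`. -/

section Levels

variable {p : ℕ} [Fact p.Prime]

/-- For `χ ≠ 1` the infimum in `level` is a true minimum: the annihilators exhaust `X` and intersect
in `{1}`. -/
theorem level_spec {χ : CharGroup p} (hχ : χ ≠ 1) (n : ℤ) : χ ∈ annih p n ↔ level χ ≤ n := by
  have hne : {n : ℤ | χ ∈ annih p n}.Nonempty := by
    obtain ⟨k, hk⟩ := Set.mem_iUnion.1 (iUnion_annih (p := p) ▸ Set.mem_univ χ)
    exact ⟨k, hk⟩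
  have hbdd : BddBelow {n : ℤ | χ ∈ annih p n} := by
    obtain ⟨k, hk⟩ : ∃ k : ℕ, χ ∉ annih p (-(k : ℤ)) := by
      by_contra! h
      exact hχ (eq_one_of_forall_mem_annih h)
    exact ⟨-(k : ℤ), fun n hn => le_of_not_gt fun hlt => hk (annih_mono hlt.le hn)⟩
  exact ⟨fun h => csInf_le hbdd h, fun h => annih_mono h (Int.csInf_mem hne hbdd)⟩

theorem level_cdil {χ : CharGroup p} (hχ : χ ≠ 1) (n : ℤ) : level (cdil n χ) = level χ + n := by
  have hχ' : cdil n χ ≠ 1 := mt cdil_eq_one.1 hχ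
  refine le_antisymm ?_ ?_
  · rw [← level_spec hχ', cdil_mem_annih, level_spec hχ]; lia
  · have := (level_spec hχ' _).2 le_rfl
    rw [cdil_mem_annih, level_spec hχ] at this
    lia

theorem cnorm_of_ne_one {χ : CharGroup p} (hχ : χ ≠ 1) : cnorm χ = (p : ℝ) ^ level χ := if_neg hχ

theorem le_logPlus {χ : CharGroup p} (hχ : χ ≠ 1) : (level χ : ℝ) ≤ logPlus χ := by
  have hp := one_lt_p p
  rw [logPlus, cnorm_of_ne_one hχ]
  split_ifs with h
  · rw [← Real.rpow_intCast, Real.logb_rpow (by positivity) hp.ne']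
  · have : level χ ≤ 0 := by
      by_contra! h'
      exact h (one_lt_zpow₀ hp h')
    exact_mod_cast this

namespace WaveletSystem

variable {M N q : ℕ} (W : WaveletSystem p M N q)

theorem t_le_l (j : Fin q) : W.t j ≤ W.l := Finset.le_sup (Finset.mem_univ j)

/-- Dilating `χ` to the tiled annulus puts it in `E_j 𝒜^{n + t(j)}` with `n = level χ - (M + 1)`.
Off the cover `n + t(j) ≥ K + 1`, and `t(j) ≤ l`. -/
theorem level_of_notMem_cover {K : ℤ} {χ : CharGroup p} (hχ : χ ≠ 1) (h : χ ∉ W.cover K) :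
    M + K + 2 ≤ level χ + W.l := by
  set n := level χ - (M + 1) with hn
  have h1 : cdil (-n) χ ∈ annih p (M + 1) \ annih p M := by
    rw [Set.mem_sdiff, cdil_mem_annih, cdil_mem_annih, level_spec hχ, level_spec hχ]
    constructor <;> lia
  rw [← W.tiling] at h1
  obtain ⟨j, hj⟩ := Set.mem_iUnion.1 h1
  have h2 : χ ∈ W.dilE (n + W.t j) j := by
    rw [mem_dilE, show (W.t j : ℤ) - (n + W.t j) = -n by ring]
    exact hj
  have h3 : ¬ n + W.t j ≤ K := fun hle => h (Set.mem_iUnion.2 ⟨(⟨_, hle⟩, j), h2⟩)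
  have := W.t_le_l j
  lia

theorem err_eq_lintegral (f : Lp ℂ 2 (mu p)) (K : ℤ) :
    W.err f K = (∫⁻ χ in (W.cover K)ᶜ, ‖fhat f χ‖ₑ ^ 2 ∂(nu p)) ^ (1 / 2 : ℝ) := by
  obtain ⟨g, hg, hTg⟩ := W.exists_hasSum_term K f
  rw [err, hg.tsum_eq, ← (plancherel p).enorm_map, Lp.enorm_def, eLpNorm_two_eq_lintegral,
    ← lintegral_indicator (W.measurableSet_cover K).compl]
  congr 1
  refine lintegral_congr_ae ?_
  rw [map_sub]
  filter_upwards [hTg, fhat_ae_eq_plancherel f,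
    Lp.coeFn_sub (plancherel p f) (plancherel p g)] with χ h1 h2 h3
  rw [h3, Pi.sub_apply, h1]
  by_cases h : χ ∈ W.cover K <;> simp [h, h2]

/-- If a weight is bounded below by `c` off the covered frequencies, then the error is at most
`c⁻¹` times the weighted norm. -/
theorem err_le {K : ℤ} (f : Lp ℂ 2 (mu p)) {w : CharGroup p → ℝ} {c : ℝ} (hc : 0 < c)
    (hw : ∀ χ, χ ≠ 1 → χ ∉ W.cover K → c ≤ w χ) {C : ℝ} (hC : 1 ≤ C * c) :
    W.err f K ≤ ENNReal.ofReal C * weightedNorm w f := by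
  have hC0 : 0 < C := pos_of_mul_pos_left (zero_lt_one.trans_le hC) hc.le
  have key : ∫⁻ χ in (W.cover K)ᶜ, ‖fhat f χ‖ₑ ^ 2 ∂(nu p) ≤
      ENNReal.ofReal (C ^ 2) * ∫⁻ χ, ENNReal.ofReal (w χ ^ 2 * ‖fhat f χ‖ ^ 2) ∂(nu p) := by
    rw [← lintegral_const_mul' _ _ ENNReal.ofReal_ne_top,
      ← lintegral_indicator (W.measurableSet_cover K).compl]
    refine lintegral_mono_ae ?_
    -- The trivial character, where weights take conventional values, is a null set.
    have hne : ∀ᵐ χ ∂(nu p), χ ≠ 1 := by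
      rw [ae_iff]
      simpa using nu_singleton_one (p := p)
    filter_upwards [hne] with χ hχ
    by_cases h : χ ∈ W.cover K
    · simp [h]
    · rw [Set.indicator_of_mem h, ← ENNReal.ofReal_mul (sq_nonneg C), ← ofReal_norm,
        ← ENNReal.ofReal_pow (norm_nonneg _)]
      refine ENNReal.ofReal_le_ofReal ?_
      have h1 : 1 ≤ C * w χ := hC.trans (mul_le_mul_of_nonneg_left (hw χ hχ h) hC0.le)
      have h2 : 1 ≤ (C * w χ) ^ 2 := one_le_pow₀ h1
      calc ‖fhat f χ‖ ^ 2 ≤ (C * w χ) ^ 2 * ‖fhat f χ‖ ^ 2 :=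
            le_mul_of_one_le_left (sq_nonneg _) h2
        _ = C ^ 2 * (w χ ^ 2 * ‖fhat f χ‖ ^ 2) := by ring
  rw [err_eq_lintegral, weightedNorm]
  refine (ENNReal.rpow_le_rpow key (by norm_num)).trans (le_of_eq ?_)
  rw [ENNReal.mul_rpow_of_nonneg _ _ (by norm_num),
    ENNReal.ofReal_rpow_of_nonneg (sq_nonneg C) (by norm_num), ← Real.sqrt_eq_rpow,
    Real.sqrt_sq hC0.le]

end WaveletSystem

end Levels

/-! ### Each constant times the lower bound of its weight is at least one. -/

section Estimates

theorem one_le_const {p M : ℕ} (hp : (1 : ℝ) < p) (hM : 1 ≤ M) (N : ℕ) :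
    1 ≤ ((N : ℝ) + 1) * (p : ℝ) ^ (((M : ℝ) - 1) / 2) := by
  have h1 : (1 : ℝ) ≤ (p : ℝ) ^ (((M : ℝ) - 1) / 2) := by
    refine Real.one_le_rpow hp.le ?_
    have : (1 : ℝ) ≤ M := by exact_mod_cast hM
    linarith
  have h2 : (1 : ℝ) ≤ (N : ℝ) + 1 := by linarith [(Nat.cast_nonneg N : (0 : ℝ) ≤ N)]
  exact one_le_mul_of_one_le_of_one_le h2 h1

/-- The first term of the tail, `n = K + 1`, already suffices: it is `1 / γ (K + 2) ≥ 1 / γ (M + K +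
2)` by monotonicity. -/
theorem step_const_bound {γ : ℤ → ℝ} (hmono : Monotone γ) (hneg : ∀ n < 0, γ n = 1)
    (hsum : Summable fun n : ℕ => 1 / γ n) (M K : ℕ) {A : ℝ} (hA : 1 ≤ A) :
    1 ≤ A * (∑' n : {n : ℕ // K < n}, 1 / γ ((n : ℕ) + 1)) * γ (M + K + 2) := by
  have hpos : ∀ n, 0 < γ n := fun n => by
    have h1 : γ (min n (-1)) ≤ γ n := hmono (min_le_left _ _)
    rw [hneg _ (by lia)] at h1
    linarith
  have hs : Summable fun n : {n : ℕ // K < n} => 1 / γ ((n : ℕ) + 1) := by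
    have h1 : Summable fun n : ℕ => 1 / γ ((n : ℤ) + 1) := by
      have := (summable_nat_add_iff 1).2 hsum
      simpa using this
    exact h1.subtype {n | K < n}
  have h1 : 1 / γ (M + K + 2) ≤ ∑' n : {n : ℕ // K < n}, 1 / γ ((n : ℕ) + 1) := by
    refine le_trans ?_ (hs.le_tsum ⟨K + 1, by lia⟩ fun n _ => (one_div_pos.2 (hpos _)).le)
    refine one_div_le_one_div_of_le (hpos _) (hmono ?_)
    push_cast
    lia
  have h2 := hpos (M + K + 2)
  rw [div_le_iff₀ h2] at h1
  rw [mul_assoc]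
  exact one_le_mul_of_one_le_of_one_le hA h1

theorem power_const_bound {p M K : ℕ} (hp : (1 : ℝ) < p) {m A : ℝ} (hm : 0 < m) (hA : 1 ≤ A) :
    1 ≤ A / (((p : ℝ) ^ m - 1) * (p : ℝ) ^ (m * (K + 1))) * (p : ℝ) ^ (m * (M + K + 2)) := by
  have h0 : (0 : ℝ) < p := by linarith
  have h1 : 0 < (p : ℝ) ^ m - 1 := sub_pos.2 (Real.one_lt_rpow hp hm)
  have h2 : 0 < (p : ℝ) ^ (m * (K + 1)) := Real.rpow_pos_of_pos h0 _
  have h3 : (p : ℝ) ^ m * (p : ℝ) ^ (m * (K + 1)) ≤ (p : ℝ) ^ (m * (M + K + 2)) := by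
    rw [← Real.rpow_add h0]
    refine Real.rpow_le_rpow_of_exponent_le hp.le ?_
    nlinarith [mul_nonneg hm.le (Nat.cast_nonneg M : (0 : ℝ) ≤ M)]
  rw [div_mul_eq_mul_div, one_le_div (mul_pos h1 h2)]
  calc ((p : ℝ) ^ m - 1) * (p : ℝ) ^ (m * (K + 1)) ≤ (p : ℝ) ^ m * (p : ℝ) ^ (m * (K + 1)) := by
        gcongr; linarith
    _ ≤ (p : ℝ) ^ (m * (M + K + 2)) := h3
    _ ≤ A * (p : ℝ) ^ (m * (M + K + 2)) :=
        le_mul_of_one_le_left (Real.rpow_nonneg h0.le _) hA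

/-- What is needed is `ε (1+K)^{ε/2} ≤ (K+3)^{1+ε/2}`, that is, `ε / (K+3)` at most the power `ε/2`
of the ratio `(K+3)/(1+K)`. It follows from `exp u ≥ u`, once the logarithm of the ratio is at least
`2/(K+3)`. -/
theorem log_const_bound (M N K : ℕ) {ε : ℝ} (hε : 0 < ε) :
    1 ≤ 2 * ((N : ℝ) + 1) / (ε * (1 + (K : ℝ)) ^ (ε / 2)) *
      ((M : ℝ) + K + 3) ^ (1 + ε / 2) := by
  have hK : (0 : ℝ) ≤ K := Nat.cast_nonneg K
  have hM : (0 : ℝ) ≤ M := Nat.cast_nonneg M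
  have hN : (0 : ℝ) ≤ N := Nat.cast_nonneg N
  have ha : (0 : ℝ) < 1 + K := by linarith
  have hb : (0 : ℝ) < (K : ℝ) + 3 := by linarith
  have h1 : ε / 2 * (2 / ((K : ℝ) + 3)) * (1 + (K : ℝ)) ^ (ε / 2) ≤
      ((K : ℝ) + 3) ^ (ε / 2) := by
    -- This is `log y ≥ 1 - 1/y` at `y = (K+3)/(1+K)`.
    have hlog : 2 / ((K : ℝ) + 3) ≤ Real.log (((K : ℝ) + 3) / (1 + K)) := by
      have := Real.one_sub_inv_le_log_of_pos (div_pos hb ha)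
      refine le_trans (le_of_eq ?_) this
      field_simp
      ring
    have h2 : ε / 2 * (2 / ((K : ℝ) + 3)) ≤ (((K : ℝ) + 3) / (1 + K)) ^ (ε / 2) := by
      rw [Real.rpow_def_of_pos (div_pos hb ha)]
      calc ε / 2 * (2 / ((K : ℝ) + 3)) ≤ ε / 2 * Real.log (((K : ℝ) + 3) / (1 + K)) := by gcongr
        _ ≤ Real.exp (Real.log (((K : ℝ) + 3) / (1 + K)) * (ε / 2)) := by
            rw [mul_comm]
            linarith [Real.add_one_le_exp (Real.log (((K : ℝ) + 3) / (1 + K)) * (ε / 2))]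
    rw [Real.div_rpow hb.le ha.le] at h2
    exact (le_div_iff₀ (Real.rpow_pos_of_pos ha _)).1 h2
  have h2 : ε * (1 + (K : ℝ)) ^ (ε / 2) ≤ ((K : ℝ) + 3) ^ (1 + ε / 2) := by
    rw [Real.rpow_add hb, Real.rpow_one]
    calc ε * (1 + (K : ℝ)) ^ (ε / 2) =
        ((K : ℝ) + 3) * (ε / 2 * (2 / ((K : ℝ) + 3)) * (1 + (K : ℝ)) ^ (ε / 2)) := by
          field_simp
      _ ≤ _ := mul_le_mul_of_nonneg_left h1 hb.le
  have h3 : ((K : ℝ) + 3) ^ (1 + ε / 2) ≤ ((M : ℝ) + K + 3) ^ (1 + ε / 2) :=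
    Real.rpow_le_rpow hb.le (by linarith) (by positivity)
  have h4 : (0 : ℝ) ≤ ((M : ℝ) + K + 3) ^ (1 + ε / 2) := by positivity
  rw [div_mul_eq_mul_div, one_le_div (by positivity)]
  nlinarith

end Estimates

end PadicFrame

/-! ### The main theorem: each weight against the level bound. -/

theorem mainTheorem2 (p : ℕ) [Fact p.Prime] (M N q : ℕ) (hM : 1 ≤ M) (hN : 1 ≤ N)
    (W : PadicFrame.WaveletSystem p M N q) (f : Lp ℂ 2 (PadicFrame.mu p))
    (K : ℕ) (hK : N < K) :
    -- the series in the definition of the error converges unconditionally in `L₂`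
    Summable (W.term f K) ∧
    -- general step weights
    (∀ γ : ℤ → ℝ, Monotone γ → Tendsto γ atTop atTop → (∀ n < 0, γ n = 1) →
      Summable (fun n : ℕ => 1 / γ n) →
      W.err f K ≤ ENNReal.ofReal ((N + 1) * (p : ℝ) ^ (((M : ℝ) - 1) / 2)) *
        PadicFrame.weightedNorm
          (fun χ => PadicFrame.stepWeight γ (PadicFrame.cdil (W.l : ℤ) χ)) f *
        ENNReal.ofReal (∑' n : {n : ℕ // K < n}, 1 / γ ((n : ℕ) + 1))) ∧
    -- power weights
    (∀ m : ℝ, 0 < m →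
      W.err f K ≤ ENNReal.ofReal ((N + 1) * (p : ℝ) ^ (((M : ℝ) - 1) / 2) /
          (((p : ℝ) ^ m - 1) * (p : ℝ) ^ (m * (K + 1)))) *
        PadicFrame.weightedNorm
          (fun χ => 1 + PadicFrame.cnorm (PadicFrame.cdil (W.l : ℤ) χ) ^ m) f ∧
      W.err f K ≤ ENNReal.ofReal ((N + 1) * (p : ℝ) ^ (((M : ℝ) - 1) / 2) *
          (p : ℝ) ^ (m * W.l) / (((p : ℝ) ^ m - 1) * (p : ℝ) ^ (m * (K + 1)))) *
        PadicFrame.weightedNorm (fun χ => 1 + PadicFrame.cnorm χ ^ m) f) ∧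
    -- logarithmic weights
    (∀ ε : ℝ, 0 < ε →
      W.err f K ≤ ENNReal.ofReal (2 * (N + 1) / (ε * (1 + (K : ℝ)) ^ (ε / 2))) *
        PadicFrame.weightedNorm
          (fun χ => (1 + W.l + PadicFrame.logPlus χ) ^ (1 + ε / 2)) f) := by
  have hp := PadicFrame.one_lt_p p
  have hp0 : (0 : ℝ) < p := by linarith
  set A : ℝ := ((N : ℝ) + 1) * (p : ℝ) ^ (((M : ℝ) - 1) / 2) with hA_def
  have hA : 1 ≤ A := PadicFrame.one_le_const hp hM N
  have hlev (χ : PadicFrame.CharGroup p) (hχ : χ ≠ 1) (h : χ ∉ W.cover K) :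
      (M : ℤ) + K + 2 ≤ PadicFrame.level χ + W.l := W.level_of_notMem_cover hχ h
  have hlevR (χ : PadicFrame.CharGroup p) (hχ : χ ≠ 1) (h : χ ∉ W.cover K) :
      (M : ℝ) + K + 2 ≤ PadicFrame.level χ + W.l := by exact_mod_cast hlev χ hχ h
  have hcd (χ : PadicFrame.CharGroup p) (hχ : χ ≠ 1) : PadicFrame.cdil (W.l : ℤ) χ ≠ 1 :=
    mt PadicFrame.cdil_eq_one.1 hχ
  refine ⟨?_, fun γ hmono _ hneg hsum => ?_, fun m hm => ⟨?_, ?_⟩, fun ε hε => ?_⟩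
  · obtain ⟨g, hg, -⟩ := W.exists_hasSum_term K f
    exact hg.summable
  · have hc : 0 < γ (M + K + 2) := by
      have h1 : γ (-1) ≤ γ (M + K + 2) := hmono (by lia)
      rw [hneg _ (by lia)] at h1
      linarith
    have h := W.err_le f hc (K := K)
      (w := fun χ => PadicFrame.stepWeight γ (PadicFrame.cdil (W.l : ℤ) χ))
      (fun χ hχ hn => by
        rw [PadicFrame.stepWeight, if_neg (hcd χ hχ), PadicFrame.level_cdil hχ]
        exact hmono (hlev χ hχ hn))
      (PadicFrame.step_const_bound hmono hneg hsum M K hA)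
    rw [ENNReal.ofReal_mul (by linarith)] at h
    rwa [mul_right_comm]
  · refine W.err_le f (Real.rpow_pos_of_pos hp0 (m * (M + K + 2))) (fun χ hχ hn => ?_)
      (PadicFrame.power_const_bound hp hm hA)
    rw [PadicFrame.cnorm_of_ne_one (hcd χ hχ), PadicFrame.level_cdil hχ, ← Real.rpow_intCast,
      ← Real.rpow_mul hp0.le, mul_comm m]
    refine le_add_of_nonneg_of_le zero_le_one (Real.rpow_le_rpow_of_exponent_le hp.le ?_)
    push_cast
    exact mul_le_mul_of_nonneg_right (hlevR χ hχ hn) hm.le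
  -- Without the dilation by `l` the weight is only bounded below by `p^{m(M+K+2-l)}`; the factor
  -- `p^{ml}` in the constant compensates exactly.
  · refine W.err_le f (Real.rpow_pos_of_pos hp0 (m * (M + K + 2 - W.l))) (fun χ hχ hn => ?_) ?_
    · rw [PadicFrame.cnorm_of_ne_one hχ, ← Real.rpow_intCast, ← Real.rpow_mul hp0.le, mul_comm m]
      refine le_add_of_nonneg_of_le zero_le_one (Real.rpow_le_rpow_of_exponent_le hp.le ?_)
      exact mul_le_mul_of_nonneg_right (by linarith [hlevR χ hχ hn]) hm.le
    · refine (PadicFrame.power_const_bound (M := M) (K := K) hp hm hA).trans (le_of_eq ?_)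
      rw [show m * ((M : ℝ) + K + 2) = m * W.l + m * (M + K + 2 - W.l) by ring,
        Real.rpow_add hp0]
      ring
  -- The base `M + K + 3` is the level bound `M + K + 2` plus the `1` in the weight.
  · refine W.err_le f (c := ((M : ℝ) + K + 3) ^ (1 + ε / 2)) (by positivity)
      (fun χ hχ hn => ?_) (PadicFrame.log_const_bound M N K hε)
    refine Real.rpow_le_rpow (by positivity) ?_ (by positivity)
    linarith [hlevR χ hχ hn, PadicFrame.le_logPlus hχ]
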